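/- Let $n,p\ge 0$ and let $s\ge 3$ be an order of differentiability ($s\in\{3,4,\dots,\infty,\omega\}$). Let $\Omega\subset\mathbb R^n$ be open, let $h:\mathbb R^n\to\mathbb R^p$ be a $C^s$ map whose differential has rank $p$ at every point of $\Omega$, and let $P$ and $Q$ be $C^s$ Riemannian metrics on $\mathbb R^n$ and $\mathbb R^p$, viewed as fields of symmetric positive definite matrices. For $x\in\Omega$ let $D^{\tau}(x)=\{v:\ \frac{\partial h}{\partial x}(x)v=0\}$ and let $D_P^{\perp}(x)=\{v:\ u^\top P(x)v=0\ \ \forall u\in D^{\tau}(x)\}$. Assume: (i) (Condition A3: $h$ is geodesically monotone on $\Omega$.) There is a $C^2$ function $\wp:\mathbb R^p\times\mathbb R^p\to[0,\infty)$ such that, for all $y\in h(\Omega)$, $\wp(y,y)=0$ and the second differential $d_1^2\wp(y,y)$ with respect to the first argument is positive definite, and such that for every geodesic $\gamma$ of $P$ taking values in $\Omega$ and minimizing (for the Riemannian distance of $P$ on $\mathbb R^n$) on the open interval $I$, where $I$ is maximal with these properties, and for all $s_3<s_4$ in $I$ with $h(\gamma(s_3))\ne h(\gamma(s_4))$, $$\frac{d}{d\sigma}\,\wp\big(h(\gamma(\sigma)),h(\gamma(s_3))\big)>0\qquad\forall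 \sigma\in(s_3,s_4).$$ (ii) (The distribution $D_P^\perp$ is integrable.) Every $x_0\in\Omega$ has an open neighborhood $U\subset\Omega$ and a $C^s$ map $h^\perp:U\to\mathbb R^{n-p}$ such that $(h,h^\perp)$ is a $C^s$ diffeomorphism from $U$ onto an open set and $\frac{\partial h^\perp}{\partial x}(x)v=0$ for all $x\in U$ and $v\in D_P^\perp(x)$. Let $$P_{mod}(x)=P(x)+\frac{\partial h}{\partial x}(x)^\top\left[Q(h(x))-\left(\frac{\partial h}{\partial x}(x)P(x)^{-1}\frac{\partial h}{\partial x}(x)^\top\right)^{-1}\right]\frac{\partial h}{\partial x}(x).$$ Then $P_{mod}$ is a Riemannian metric on $\Omega$, of class $C^r$ whenever $r+1\le s$; it modifies only the $y$-block, i.e. $u^\top P_{mod}(x)v=u^\top P(x)v$ for all $x\in\Omega$, $u\in\mathbb R^n$, $v\in D^{\tau}(x)$; $h$ is a Riemannian submersion on $\Omega$ for $P_{mod}$ and $Q$, i.e. $\left|\frac{\partial h}{\partial x}(x)v\right|_{Q(h(x))}=|v|_{P_{mod}(x)}$ for all $x\in\Omega$ and $v\in D_{P_{mod}}^{\perp}(x)$;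 and the second fundamental form of $h$ for $P_{mod}$ and $Q$ is zero on $\Omega$: for all $x\in\Omega$ and all indices $i,a,b$, $$\frac{\partial^2h_i}{\partial x_a\partial x_b}(x)-\sum_c\Gamma^c_{ab}(x)\frac{\partial h_i}{\partial x_c}(x)+\sum_{j,k}\Delta^i_{jk}(h(x))\frac{\partial h_j}{\partial x_a}(x)\frac{\partial h_k}{\partial x_b}(x)=0,$$ where $\Gamma^c_{ab}$ and $\Delta^i_{jk}$ are the Christoffel symbols of $P_{mod}$ and $Q$. -/

import Mathlib

open scoped Matrix

noncomputable section

/-- The partial derivative `∂f/∂x_a` at `x`. -/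
def partialDeriv {n : ℕ} (a : Fin n) (f : (Fin n → ℝ) → ℝ) (x : Fin n → ℝ) : ℝ :=
  fderiv ℝ f x (Pi.single a 1)

/-- The Jacobian matrix `∂h/∂x` at `x`. -/
def jacobian {n p : ℕ} (h : (Fin n → ℝ) → (Fin p → ℝ)) (x : Fin n → ℝ) :
    Matrix (Fin p) (Fin n) ℝ :=
  Matrix.of fun i a => partialDeriv a (fun z => h z i) x

/-- `P` is a Riemannian metric of class `C^r` on the set `U` (meant to be open): a field of
symmetric positive definite matrices with entries of class `C^r`. -/
def IsRiemannianMetricOn {n : ℕ} (r : WithTop ℕ∞) (U : Set (Fin n → ℝ))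
    (P : (Fin n → ℝ) → Matrix (Fin n) (Fin n) ℝ) : Prop :=
  (∀ a b, ContDiffOn ℝ r (fun x => P x a b) U) ∧ ∀ x ∈ U, (P x).PosDef

/-- The Christoffel symbol `Γ^c_{ab}` of the metric `P` at `x`. -/
def christoffel {n : ℕ} (P : (Fin n → ℝ) → Matrix (Fin n) (Fin n) ℝ) (c a b : Fin n)
    (x : Fin n → ℝ) : ℝ :=
  (1 / 2 : ℝ) * ∑ d, (P x)⁻¹ c d *
    (partialDeriv b (fun z => P z a d) x + partialDeriv a (fun z => P z b d) x
      - partialDeriv d (fun z => P z a b) x)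

/-- `γ` satisfies the geodesic equation of the metric `P` on the (open) set `I` of times. -/
def IsGeodesicOn {n : ℕ} (P : (Fin n → ℝ) → Matrix (Fin n) (Fin n) ℝ) (γ : ℝ → (Fin n → ℝ))
    (I : Set ℝ) : Prop :=
  ContDiffOn ℝ 2 γ I ∧
    ∀ s ∈ I, ∀ c, deriv (deriv γ) s c =
      -∑ a, ∑ b, christoffel P c a b (γ s) * deriv γ s a * deriv γ s b

/-- The length of the path `γ` between the times `a` and `b`. -/
def pathLength {n : ℕ} (P : (Fin n → ℝ) → Matrix (Fin n) (Fin n) ℝ) (γ : ℝ → (Fin n → ℝ))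
    (a b : ℝ) : ℝ :=
  ∫ s in a..b, Real.sqrt (deriv γ s ⬝ᵥ (P (γ s) *ᵥ deriv γ s))

/-- `γ` is piecewise `C¹` on `[a, b]`: there is a subdivision `a = τ 0 ≤ τ 1 ≤ … ≤ τ k = b` such
that `γ` is `C¹` on each closed piece. -/
def IsPiecewiseC1On {n : ℕ} (γ : ℝ → (Fin n → ℝ)) (a b : ℝ) : Prop :=
  ∃ (k : ℕ) (τ : ℕ → ℝ), Monotone τ ∧ τ 0 = a ∧ τ k = b ∧
    ∀ i < k, ContDiffOn ℝ 1 γ (Set.Icc (τ i) (τ (i + 1)))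

/-- The Riemannian distance of the metric `P` on `ℝⁿ`. -/
def riemannianDistance {n : ℕ} (P : (Fin n → ℝ) → Matrix (Fin n) (Fin n) ℝ)
    (x y : Fin n → ℝ) : ℝ :=
  sInf {L : ℝ | ∃ (a b : ℝ) (γ : ℝ → (Fin n → ℝ)),
    a ≤ b ∧ IsPiecewiseC1On γ a b ∧ γ a = x ∧ γ b = y ∧ L = pathLength P γ a b}

/-- `γ` minimizes the length between any two of its points with times in `I`. -/
def IsMinimizingOn {n : ℕ} (P : (Fin n → ℝ) → Matrix (Fin n) (Fin n) ℝ) (γ : ℝ → (Fin n → ℝ))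
    (I : Set ℝ) : Prop :=
  ∀ s ∈ I, ∀ t ∈ I, s ≤ t → pathLength P γ s t = riemannianDistance P (γ s) (γ t)

/-- `γ`, on the open (possibly unbounded) interval `I`, is a geodesic that takes values in `Ω` and
is minimizing. -/
def IsMinimizingGeodesicIn {n : ℕ} (P : (Fin n → ℝ) → Matrix (Fin n) (Fin n) ℝ)
    (Ω : Set (Fin n → ℝ)) (γ : ℝ → (Fin n → ℝ)) (I : Set ℝ) : Prop :=
  IsOpen I ∧ I.OrdConnected ∧ I.Nonempty ∧ IsGeodesicOn P γ I ∧ IsMinimizingOn P γ I ∧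
    Set.MapsTo γ I Ω

/-- `I` is moreover maximal: no extension of `γ` to a larger open interval has these properties. -/
def IsMaximalMinimizingGeodesicIn {n : ℕ} (P : (Fin n → ℝ) → Matrix (Fin n) (Fin n) ℝ)
    (Ω : Set (Fin n → ℝ)) (γ : ℝ → (Fin n → ℝ)) (I : Set ℝ) : Prop :=
  IsMinimizingGeodesicIn P Ω γ I ∧
    ∀ (γ' : ℝ → (Fin n → ℝ)) (I' : Set ℝ), IsMinimizingGeodesicIn P Ω γ' I' →
      I ⊆ I' → Set.EqOn γ γ' I → I' = I

/-- Geodesic monotonicity of `h` on `Ω` for the metric `P`: there is a `C²` gauge function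
`w ≥ 0` on `ℝᵖ × ℝᵖ`, vanishing with positive definite second differential in the first argument
at the diagonal points over `h(Ω)`, such that `s ↦ w (h (γ s)) (h (γ s₃))` has positive
derivative on `(s₃, s₄)` along every geodesic `γ` in `Ω` that is minimizing on the maximal interval
`I`, for all `s₃ < s₄` in `I` with `h (γ s₃) ≠ h (γ s₄)`. -/
def GeodesicallyMonotone {n p : ℕ} (P : (Fin n → ℝ) → Matrix (Fin n) (Fin n) ℝ)
    (h : (Fin n → ℝ) → (Fin p → ℝ)) (Ω : Set (Fin n → ℝ)) : Prop :=
  ∃ w : (Fin p → ℝ) → (Fin p → ℝ) → ℝ,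
    ContDiff ℝ 2 (fun y : (Fin p → ℝ) × (Fin p → ℝ) => w y.1 y.2) ∧
    (∀ y₁ y₂, 0 ≤ w y₁ y₂) ∧
    (∀ y ∈ h '' Ω, w y y = 0 ∧
      ∀ v : Fin p → ℝ, v ≠ 0 → 0 < fderiv ℝ (fderiv ℝ (fun y₁ => w y₁ y)) y v v) ∧
    ∀ (γ : ℝ → (Fin n → ℝ)) (I : Set ℝ), IsMaximalMinimizingGeodesicIn P Ω γ I →
      ∀ s₃ ∈ I, ∀ s₄ ∈ I, s₃ < s₄ → h (γ s₃) ≠ h (γ s₄) →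
        ∀ s ∈ Set.Ioo s₃ s₄, 0 < deriv (fun t => w (h (γ t)) (h (γ s₃))) s

/-- The tangent distribution of the level sets of `h`. -/
def tangentDistribution {n p : ℕ} (h : (Fin n → ℝ) → (Fin p → ℝ)) (x : Fin n → ℝ) :
    Set (Fin n → ℝ) :=
  {v | jacobian h x *ᵥ v = 0}

/-- The orthogonal distribution: the `P`-orthogonal complement of the tangent distribution. -/
def orthogonalDistribution {n p : ℕ} (P : (Fin n → ℝ) → Matrix (Fin n) (Fin n) ℝ)
    (h : (Fin n → ℝ) → (Fin p → ℝ)) (x : Fin n → ℝ) : Set (Fin n → ℝ) :=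
  {v | ∀ u ∈ tangentDistribution h x, u ⬝ᵥ (P x *ᵥ v) = 0}

/-- The orthogonal distribution is integrable, everywhere locally on `Ω`: around each point of `Ω`
there is a `C^s` diffeomorphism `θ = (h, k)` between open sets, with `k` valued in `ℝ^(n-p)`, such
that the differential of `k` vanishes on the orthogonal distribution. -/
def OrthogonalDistributionIntegrable {n p : ℕ} (s : WithTop ℕ∞)
    (P : (Fin n → ℝ) → Matrix (Fin n) (Fin n) ℝ)
    (h : (Fin n → ℝ) → (Fin p → ℝ)) (Ω : Set (Fin n → ℝ)) : Prop :=
  ∀ x₀ ∈ Ω, ∃ θ : OpenPartialHomeomorph (Fin n → ℝ) ((Fin p → ℝ) × (Fin (n - p) → ℝ)),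
    x₀ ∈ θ.source ∧ θ.source ⊆ Ω ∧
    ContDiffOn ℝ s θ θ.source ∧ ContDiffOn ℝ s θ.symm θ.target ∧
    (∀ x ∈ θ.source, (θ x).1 = h x) ∧
    ∀ x ∈ θ.source, ∀ v ∈ orthogonalDistribution P h x, fderiv ℝ (fun z => (θ z).2) x v = 0

/-- The modified metric
`P_mod = P + (∂h/∂x)ᵀ [Q ∘ h - ((∂h/∂x) P⁻¹ (∂h/∂x)ᵀ)⁻¹] (∂h/∂x)`. -/
def modifiedMetric {n p : ℕ} (P : (Fin n → ℝ) → Matrix (Fin n) (Fin n) ℝ)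
    (Q : (Fin p → ℝ) → Matrix (Fin p) (Fin p) ℝ) (h : (Fin n → ℝ) → (Fin p → ℝ))
    (x : Fin n → ℝ) : Matrix (Fin n) (Fin n) ℝ :=
  P x + (jacobian h x)ᵀ *
    (Q (h x) - (jacobian h x * (P x)⁻¹ * (jacobian h x)ᵀ)⁻¹) * jacobian h x

/-- `h` is a Riemannian submersion on `Ω` from the metric `P` to the metric `Q`: it is a submersion
preserving the length of orthogonal vectors. -/
def IsRiemannianSubmersionOn {n p : ℕ} (P : (Fin n → ℝ) → Matrix (Fin n) (Fin n) ℝ)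
    (Q : (Fin p → ℝ) → Matrix (Fin p) (Fin p) ℝ) (h : (Fin n → ℝ) → (Fin p → ℝ))
    (Ω : Set (Fin n → ℝ)) : Prop :=
  ∀ x ∈ Ω, (jacobian h x).rank = p ∧
    ∀ v ∈ orthogonalDistribution P h x,
      (jacobian h x *ᵥ v) ⬝ᵥ (Q (h x) *ᵥ (jacobian h x *ᵥ v)) = v ⬝ᵥ (P x *ᵥ v)

/-- The component `II_P h^i_{ab}` of the second fundamental form of the map `h` from the metric `P`
to the metric `Q`. -/
def secondFundamentalForm {n p : ℕ} (P : (Fin n → ℝ) → Matrix (Fin n) (Fin n) ℝ)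
    (Q : (Fin p → ℝ) → Matrix (Fin p) (Fin p) ℝ) (h : (Fin n → ℝ) → (Fin p → ℝ))
    (i : Fin p) (a b : Fin n) (x : Fin n → ℝ) : ℝ :=
  partialDeriv a (partialDeriv b (fun z => h z i)) x
    - ∑ c, christoffel P c a b x * partialDeriv c (fun z => h z i) x
    + ∑ j, ∑ k, christoffel Q i j k (h x) *
        partialDeriv a (fun z => h z j) x * partialDeriv b (fun z => h z k) x

end

open scoped Matrix

set_option maxSynthPendingDepth 3

/-! ### Matrices as bilinear forms -/

noncomputable section

/-! Write J for the Jacobian of h and A = (J P⁻¹ Jᵀ)⁻¹. The metric splits as P = Jᵀ A J + R, where R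
vanishes on the orthogonal distribution and agrees with P on vertical vectors (the kernel of J).
Then P_mod = Jᵀ (Q ∘ h) J + R: only the horizontal part changes, into the pullback of Q. Positivity
and the submersion property follow by linear algebra.

For the second fundamental form, write dh_i = P_mod X with X horizontal. The Christoffel symbols of
a metric M contracted with M X become half the Koszul expression D_v M(u, X) + D_u M(v, X) - D_X
M(u, v). By `koszul_congruence` the pullback of Q produces exactly the Hessian of h_i and the
Christoffel symbols of Q, so everything cancels except the Koszul expression of R, and
`koszul_vertical_eq_zero` remains to be shown.

Integrability makes R the pullback, by a map k with Dk X = 0, of a field B of forms on ℝ^(n-p)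
(`exists_vertical_form`); what remains is -D_X B. The same computation for P on vertical vectors
shows that D_X B vanishes as soon as the Hessian of h for P does so there, that is, when the level
sets are totally geodesic (`hessian_eq_zero_of_tangent`).

This last fact comes from monotonicity: along a minimizing geodesic tangent to a level set at time
0, the gauge has zero derivative at 0, which forbids different values of h on the two sides, so h is
constant (`GeodesicallyMonotone.eq_of_tangent`). Since monotonicity concerns minimizing geodesics
only, short geodesics have to be shown minimizing (`exists_isMinimizingOn`). This is done by
calibration, with an explicit function F whose differential has norm at most 1 and which equals the
time along the geodesic. -/

/-- The continuous bilinear form `(u, v) ↦ uᵀ M v` of a square matrix `M`. -/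
def matrixBilin {m : ℕ} (M : Matrix (Fin m) (Fin m) ℝ) :
    (Fin m → ℝ) →L[ℝ] (Fin m → ℝ) →L[ℝ] ℝ :=
  ∑ i, ∑ j, M i j • ((ContinuousLinearMap.proj i : (Fin m → ℝ) →L[ℝ] ℝ).smulRight
    (ContinuousLinearMap.proj j : (Fin m → ℝ) →L[ℝ] ℝ))

lemma matrixBilin_apply_sum {m : ℕ} (M : Matrix (Fin m) (Fin m) ℝ) (u v : Fin m → ℝ) :
    matrixBilin M u v = ∑ i, ∑ j, M i j * (u i * v j) := by
  simp [matrixBilin]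

lemma matrixBilin_apply {m : ℕ} (M : Matrix (Fin m) (Fin m) ℝ) (u v : Fin m → ℝ) :
    matrixBilin M u v = u ⬝ᵥ (M *ᵥ v) := by
  simp only [matrixBilin_apply_sum, dotProduct, Matrix.mulVec, Finset.mul_sum]
  exact Finset.sum_congr rfl fun i _ => Finset.sum_congr rfl fun j _ => by ring

lemma matrixBilin_comm {m : ℕ} {M : Matrix (Fin m) (Fin m) ℝ} (hM : M.IsSymm)
    (u v : Fin m → ℝ) : matrixBilin M u v = matrixBilin M v u := by
  rw [matrixBilin_apply_sum, matrixBilin_apply_sum, Finset.sum_comm]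
  exact Finset.sum_congr rfl fun i _ => Finset.sum_congr rfl fun j _ => by
    rw [hM.apply i j]; ring

/-! ### Regularity of fields of bilinear forms -/

section Regularity

variable {E : Type*} [NormedAddCommGroup E] [NormedSpace ℝ E]

lemma contDiffAt_sum_smul_const {F ι κ : Type*} [NormedAddCommGroup F] [NormedSpace ℝ F]
    [Fintype ι] [Fintype κ] {r : WithTop ℕ∞} {x : E} {f : E → ι → κ → ℝ} (T : ι → κ → F)
    (hf : ∀ i j, ContDiffAt ℝ r (fun y => f y i j) x) :
    ContDiffAt ℝ r (fun y => ∑ i, ∑ j, f y i j • T i j) x :=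
  ContDiffAt.sum fun i _ => ContDiffAt.sum fun j _ => (hf i j).smul contDiffAt_const

lemma hasFDerivAt_sum_smul_const {F ι κ : Type*} [NormedAddCommGroup F] [NormedSpace ℝ F]
    [Fintype ι] [Fintype κ] {x : E} {f : E → ι → κ → ℝ} (T : ι → κ → F)
    (hf : ∀ i j, DifferentiableAt ℝ (fun y => f y i j) x) :
    HasFDerivAt (fun y => ∑ i, ∑ j, f y i j • T i j)
      (∑ i, ∑ j, (fderiv ℝ (fun y => f y i j) x).smulRight (T i j)) x :=
  HasFDerivAt.fun_sum fun i _ => HasFDerivAt.fun_sum fun j _ =>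
    (hf i j).hasFDerivAt.smul_const (T i j)

variable {m : ℕ} {M : E → Matrix (Fin m) (Fin m) ℝ} {x : E}

lemma contDiffAt_matrixBilin {r : WithTop ℕ∞} (hM : ∀ i j, ContDiffAt ℝ r (fun y => M y i j) x) :
    ContDiffAt ℝ r (fun y => matrixBilin (M y)) x :=
  contDiffAt_sum_smul_const (F := (Fin m → ℝ) →L[ℝ] (Fin m → ℝ) →L[ℝ] ℝ) (f := M) _ hM

lemma differentiableAt_matrixBilin (hM : ∀ i j, DifferentiableAt ℝ (fun y => M y i j) x) :
    DifferentiableAt ℝ (fun y => matrixBilin (M y)) x :=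
  (hasFDerivAt_sum_smul_const (F := (Fin m → ℝ) →L[ℝ] (Fin m → ℝ) →L[ℝ] ℝ) (f := M) _
    hM).differentiableAt

lemma fderiv_matrixBilin (hM : ∀ i j, DifferentiableAt ℝ (fun y => M y i j) x)
    (w : E) (u v : Fin m → ℝ) :
    fderiv ℝ (fun y => matrixBilin (M y)) x w u v =
      ∑ i, ∑ j, fderiv ℝ (fun y => M y i j) x w * (u i * v j) := by
  have := (hasFDerivAt_sum_smul_const (F := (Fin m → ℝ) →L[ℝ] (Fin m → ℝ) →L[ℝ] ℝ) (f := M)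
    (fun i j => (ContinuousLinearMap.proj i : (Fin m → ℝ) →L[ℝ] ℝ).smulRight
    (ContinuousLinearMap.proj j : (Fin m → ℝ) →L[ℝ] ℝ)) hM).fderiv
  refine (congrArg (fun L => L w u v) this).trans ?_
  simp

end Regularity

/-! ### Koszul expressions and Christoffel symbols -/

section Koszul

variable {E : Type*} [NormedAddCommGroup E] [NormedSpace ℝ E]

/-- The Koszul expression `D_v B(u, w) + D_u B(v, w) - D_w B(u, v)` of a field `B` of bilinear
forms, for constant vector fields `u`, `v`, `w`. -/
def koszul (B : E → E →L[ℝ] E →L[ℝ] ℝ) (x u v w : E) : ℝ :=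
  fderiv ℝ B x v u w + fderiv ℝ B x u v w - fderiv ℝ B x w u v

variable {G : Type*} [NormedAddCommGroup G] [NormedSpace ℝ G]

/-- Product rule. The form `B` is indexed by the source point rather than by its image under `k`,
because the vertical part of a metric may vary along the fibres of `k`. -/
lemma fderiv_pullback_apply {k : E → G} {B : E → G →L[ℝ] G →L[ℝ] ℝ} {M : E → E →L[ℝ] E →L[ℝ] ℝ}
    {x : E} (hk : DifferentiableAt ℝ (fderiv ℝ k) x) (hB : DifferentiableAt ℝ B x)
    (hM : DifferentiableAt ℝ M x)
    (h : ∀ᶠ y in nhds x, ∀ u v, M y u v = B y (fderiv ℝ k y u) (fderiv ℝ k y v)) (u v w : E) :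
    fderiv ℝ M x w u v = B x (fderiv ℝ (fderiv ℝ k) x w u) (fderiv ℝ k x v)
      + B x (fderiv ℝ k x u) (fderiv ℝ (fderiv ℝ k) x w v)
      + fderiv ℝ B x w (fderiv ℝ k x u) (fderiv ℝ k x v) := by
  have h1 : HasFDerivAt (fun y => M y u v)
      (((fderiv ℝ M x).flip u).flip v) x := by
    convert! (hM.hasFDerivAt.clm_apply (hasFDerivAt_const u x)).clm_apply (hasFDerivAt_const v x) using 1
    ext z; simp
  have hku := hk.hasFDerivAt.clm_apply (hasFDerivAt_const u x)
  have hkv := hk.hasFDerivAt.clm_apply (hasFDerivAt_const v x)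
  have h2 := (hB.hasFDerivAt.clm_apply hku).clm_apply hkv
  have h3 := h2.congr_of_eventuallyEq (f₁ := fun y => M y u v) (by
    filter_upwards [h] with y hy using hy u v)
  have := congrArg (fun T => T w) (h1.unique h3)
  simp at this
  rw [this]; ring

/-- The Koszul expression of a field of bilinear forms pulled back by the differential of `k`. -/
lemma koszul_pullback {k : E → G} {B : E → G →L[ℝ] G →L[ℝ] ℝ} {M : E → E →L[ℝ] E →L[ℝ] ℝ}
    {x : E} (hk : DifferentiableAt ℝ (fderiv ℝ k) x)
    (hks : ∀ u v, fderiv ℝ (fderiv ℝ k) x u v = fderiv ℝ (fderiv ℝ k) x v u)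
    (hB : DifferentiableAt ℝ B x) (hBs : ∀ u v, B x u v = B x v u)
    (hM : DifferentiableAt ℝ M x)
    (h : ∀ᶠ y in nhds x, ∀ u v, M y u v = B y (fderiv ℝ k y u) (fderiv ℝ k y v)) (u v w : E) :
    koszul M x u v w = 2 * B x (fderiv ℝ (fderiv ℝ k) x u v) (fderiv ℝ k x w)
      + (fderiv ℝ B x v (fderiv ℝ k x u) (fderiv ℝ k x w)
        + fderiv ℝ B x u (fderiv ℝ k x v) (fderiv ℝ k x w)
        - fderiv ℝ B x w (fderiv ℝ k x u) (fderiv ℝ k x v)) := by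
  simp only [koszul, fderiv_pullback_apply hk hB hM h]
  -- Of the six terms containing a second derivative of `k`, symmetry cancels four and makes the
  -- other two equal.
  rw [hks v u, hks w u, hks w v, hBs (fderiv ℝ k x v) (fderiv ℝ (fderiv ℝ k) x u w)]
  ring

lemma fderiv_add_normed {B C : E → G} {x : E} (hB : DifferentiableAt ℝ B x)
    (hC : DifferentiableAt ℝ C x) :
    fderiv ℝ (fun y => B y + C y) x = fderiv ℝ B x + fderiv ℝ C x :=
  fderiv_fun_add hB hC

lemma koszul_add {B C : E → E →L[ℝ] E →L[ℝ] ℝ} {x : E} (hB : DifferentiableAt ℝ B x)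
    (hC : DifferentiableAt ℝ C x) (u v w : E) :
    koszul (fun y => B y + C y) x u v w = koszul B x u v w + koszul C x u v w := by
  have := fderiv_add_normed (G := E →L[ℝ] E →L[ℝ] ℝ) hB hC
  simp only [koszul, this, add_apply]
  ring

lemma koszul_congr {B C : E → E →L[ℝ] E →L[ℝ] ℝ} {x : E} (h : B =ᶠ[nhds x] C) (u v w : E) :
    koszul B x u v w = koszul C x u v w := by
  simp only [koszul, h.fderiv_eq]

end Koszul

/-- The Christoffel symbols contracted with two vectors and with a covector `M w`. -/
lemma sum_christoffel_mul {n : ℕ} {M : (Fin n → ℝ) → Matrix (Fin n) (Fin n) ℝ} {x : Fin n → ℝ}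
    (hM : ∀ i j, DifferentiableAt ℝ (fun y => M y i j) x) (hs : (M x).IsSymm)
    (hu : IsUnit (M x).det) (u v w : Fin n → ℝ) :
    ∑ c, (∑ a, ∑ b, christoffel M c a b x * u a * v b) * (M x *ᵥ w) c =
      1 / 2 * koszul (fun y => matrixBilin (M y)) x u v w := by
  set T : Fin n → ℝ := fun d => ∑ a, ∑ b, (partialDeriv b (fun z => M z a d) x +
    partialDeriv a (fun z => M z b d) x - partialDeriv d (fun z => M z a b) x) * u a * v b with hT
  have h1 : ∀ c, (∑ a, ∑ b, christoffel M c a b x * u a * v b) =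
      1 / 2 * ((M x)⁻¹ *ᵥ T) c := by
    intro c
    simp only [christoffel, Matrix.mulVec, dotProduct, hT, Finset.mul_sum, Finset.sum_mul]
    conv_rhs => rw [Finset.sum_comm]
    refine Finset.sum_congr rfl fun a _ => ?_
    conv_rhs => rw [Finset.sum_comm]
    exact Finset.sum_congr rfl fun b _ => Finset.sum_congr rfl fun d _ => by ring
  -- The covector `M w` cancels the inverse matrix, leaving the symbols of the first kind paired
  -- with `w`.
  have h2 : ∑ c, ((M x)⁻¹ *ᵥ T) c * (M x *ᵥ w) c = ∑ d, T d * w d := by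
    change ((M x)⁻¹ *ᵥ T) ⬝ᵥ (M x *ᵥ w) = T ⬝ᵥ w
    rw [Matrix.dotProduct_mulVec, ← Matrix.mulVec_transpose, hs.eq, Matrix.mulVec_mulVec,
      Matrix.mul_nonsing_inv _ hu, Matrix.one_mulVec]
  have hlin : ∀ (a b : Fin n) (z : Fin n → ℝ), fderiv ℝ (fun y => M y a b) x z =
      ∑ e, z e * partialDeriv e (fun y => M y a b) x := by
    intro a b z
    conv_lhs => rw [← Finset.univ_sum_single z, map_sum]
    refine Finset.sum_congr rfl fun e _ => ?_
    have : (Pi.single e (z e) : Fin n → ℝ) = z e • Pi.single e 1 := by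
      rw [← Pi.single_smul]; simp
    rw [this, map_smul]; rfl
  simp only [h1, mul_assoc (1 / 2 : ℝ)]
  rw [← Finset.mul_sum, h2]
  congr 1
  simp only [koszul, fderiv_matrixBilin hM, hlin, hT, Finset.sum_mul]
  have e1 : ∑ i, ∑ j, ∑ e, v e * partialDeriv e (fun y => M y i j) x * (u i * w j) =
      ∑ d, ∑ a, ∑ b, partialDeriv b (fun y => M y a d) x * u a * v b * w d := by
    rw [Finset.sum_comm]
    exact Finset.sum_congr rfl fun i _ => Finset.sum_congr rfl fun j _ =>
      Finset.sum_congr rfl fun e _ => by ring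
  have e2 : ∑ i, ∑ j, ∑ e, u e * partialDeriv e (fun y => M y i j) x * (v i * w j) =
      ∑ d, ∑ a, ∑ b, partialDeriv a (fun y => M y b d) x * u a * v b * w d := by
    rw [Finset.sum_comm]
    refine Finset.sum_congr rfl fun d _ => ?_
    rw [Finset.sum_comm]
    exact Finset.sum_congr rfl fun j _ =>
      Finset.sum_congr rfl fun e _ => by ring
  have e3 : ∑ i, ∑ j, ∑ e, w e * partialDeriv e (fun y => M y i j) x * (u i * v j) =
      ∑ d, ∑ a, ∑ b, partialDeriv d (fun y => M y a b) x * u a * v b * w d := by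
    rw [Finset.sum_comm' (t' := Finset.univ) (s' := fun _ => Finset.univ) (by simp)]
    conv_rhs => rw [Finset.sum_comm]
    conv_rhs => enter [2, a]; rw [Finset.sum_comm]
    rw [Finset.sum_comm]
    exact Finset.sum_congr rfl fun i _ => Finset.sum_congr rfl fun j _ =>
      Finset.sum_congr rfl fun e _ => by ring
  rw [e1, e2, e3]
  simp only [← Finset.sum_add_distrib, ← Finset.sum_sub_distrib]
  exact Finset.sum_congr rfl fun i _ => Finset.sum_congr rfl fun j _ =>
      Finset.sum_congr rfl fun e _ => by ring

/-! ### Quantitative estimates for the calibration -/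

open Filter Topology in
/-- Uniform second order Taylor estimate near a point. -/
lemma exists_taylor_bound {E F : Type*} [NormedAddCommGroup E] [NormedSpace ℝ E]
    [NormedAddCommGroup F] [NormedSpace ℝ F] {f : E → F} {x₀ : E} (hf : ContDiffAt ℝ 2 f x₀) :
    ∃ L : ℝ, 0 ≤ L ∧ ∃ r > 0, ∀ x ∈ Metric.ball x₀ r, ∀ y ∈ Metric.ball x₀ r,
      ‖f x - f y - fderiv ℝ f y (x - y)‖ ≤ L * ‖x - y‖ ^ 2 := by
  have h1 : ContDiffAt ℝ 1 (fderiv ℝ f) x₀ := hf.fderiv_right (by norm_num)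
  obtain ⟨K, s, hs, hK⟩ := h1.exists_lipschitzOnWith
  have hd : ∀ᶠ x in 𝓝 x₀, DifferentiableAt ℝ f x := by
    filter_upwards [hf.eventually (by norm_num)] with x hx
    exact hx.differentiableAt (by norm_num)
  obtain ⟨r, hr, hball⟩ := Metric.mem_nhds_iff.1 (inter_mem hs hd)
  refine ⟨K, K.2, r, hr, fun x hx y hy => ?_⟩
  have hseg : segment ℝ y x ⊆ Metric.ball x₀ r := (convex_ball x₀ r).segment_subset hy hx
  -- Mean value inequality for `f` minus its linear part at `y`: on the segment the differential
  -- moves by at most `K * ‖x - y‖`.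
  have := (convex_segment y x).norm_image_sub_le_of_norm_hasFDerivWithin_le'
    (f := f) (f' := fderiv ℝ f) (φ := fderiv ℝ f y) (C := K * ‖x - y‖)
    (fun z hz => ((hball (hseg hz)).2 : DifferentiableAt ℝ f z).hasFDerivAt.hasFDerivWithinAt)
    (fun z hz => ?_) (left_mem_segment ℝ y x) (right_mem_segment ℝ y x)
  · calc _ ≤ _ := this
      _ = _ := by ring
  · refine (hK.norm_sub_le (hball (hseg hz)).1 (hball hy).1).trans ?_
    gcongr
    obtain ⟨a, b, ha, hb, hab, rfl⟩ := hz
    have : a • y + b • x - y = b • (x - y) := by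
      rw [← eq_sub_iff_add_eq] at hab; rw [hab]; module
    rw [this, norm_smul, Real.norm_of_nonneg hb]
    exact mul_le_of_le_one_left (norm_nonneg _) (by linarith)

set_option maxHeartbeats 1000000 in
/-- The elementary inequality behind the calibration of short geodesics. -/
lemma exists_calibration_constant {m C : ℝ} (hm : 0 < m) (hC : 1 ≤ C) :
    ∃ K > 0, ∃ z₀ > 0, ∀ α a π q r X Z T S : ℝ, 0 ≤ X → 0 ≤ Z → Z ≤ z₀ → K * |T| ≤ 1 →
      |a - α| ≤ C * X → |π| ≤ C * Z → m * Z ^ 2 ≤ q → q ≤ C * Z ^ 2 → |r| ≤ C * Z * X →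
      α ^ 2 + m * X ^ 2 + 2 * α ^ 2 * π - C * Z * |α| * X - C * Z * X ^ 2
        - C * Z ^ 2 * (α ^ 2 + X ^ 2) ≤ S →
      (α + (a * π - K * a * q - 2 * (K * T) * r)) ^ 2 ≤ S := by
  -- Large enough to dominate the three collected error coefficients in `hCD1`, `hCD2` and `hCD3`.
  set D := 100 * C ^ 4 with hD
  have hC4 : 1 ≤ C ^ 4 := one_le_pow₀ hC
  have hDpos : 0 < D := by positivity
  -- `K` makes `2 * K * m` at least `D + D ^ 2 / (2 * m)`, the coefficient of α²Z² to be absorbed in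
  -- `k6`. The three bounds on `Z` give Z² ≤ Z, keep the terms in ZX² below half of mX² (`k5`), and
  -- make Kq at most CZ.
  refine ⟨(D + D ^ 2 / m) / m, by positivity, min (min 1 (m / (4 * D)))
    (1 / ((D + D ^ 2 / m) / m)), by positivity, ?_⟩
  set K := (D + D ^ 2 / m) / m with hK
  have hKpos : 0 < K := by positivity
  intro α a π q r X Z T S hX hZ hZ0 hT ha hπ hq hq' hr hS
  have hZ1 : Z ≤ 1 := hZ0.trans ((min_le_left _ _).trans (min_le_left _ _))
  have hZ2 : 4 * D * Z ≤ m := by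
    have := hZ0.trans ((min_le_left _ _).trans (min_le_right _ _))
    rw [le_div_iff₀ (by positivity)] at this; linarith
  have hZ3 : K * Z ≤ 1 := by
    have := hZ0.trans (min_le_right _ _)
    rw [le_div_iff₀ (by positivity)] at this; linarith
  set A := |α| with hA
  have hA0 : 0 ≤ A := abs_nonneg _
  have hA2 : α ^ 2 = A ^ 2 := (sq_abs α).symm
  have hC0 : 0 ≤ C := by linarith
  have haabs : |a| ≤ A + C * X := by
    calc |a| = |α + (a - α)| := by ring_nf
      _ ≤ |α| + |a - α| := abs_add_le _ _
      _ ≤ _ := by linarith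
  have hq0 : 0 ≤ q := le_trans (by positivity) hq
  -- each term of the correction
  have t1 : |a * π| ≤ (A + C * X) * (C * Z) := by rw [abs_mul]; gcongr
  have hKq : K * q ≤ C * Z := by
    calc K * q ≤ K * (C * Z ^ 2) := by gcongr
      _ = (K * Z) * (C * Z) := by ring
      _ ≤ 1 * (C * Z) := by gcongr
      _ = _ := by ring
  have t2 : |K * a * q| ≤ (A + C * X) * (C * Z) := by
    have : K * a * q = a * (K * q) := by ring
    rw [this, abs_mul, abs_of_nonneg (by positivity : 0 ≤ K * q)]
    gcongr
  have hKT : |K * T| ≤ 1 := by rwa [abs_mul, abs_of_pos hKpos]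
  have t3 : |K * T * r| ≤ C * Z * X := by
    rw [abs_mul]
    calc |K * T| * |r| ≤ 1 * (C * Z * X) := by gcongr
      _ = _ := by ring
  set b := a * π - K * a * q - 2 * (K * T) * r with hb
  have hbabs : |b| ≤ 6 * C ^ 2 * (Z * (A + X)) := by
    have h1 : |b| ≤ |a * π| + |K * a * q| + 2 * |K * T * r| := by
      rw [hb, abs_le]
      constructor <;>
      · have := abs_le.1 (le_refl |a * π|); have := abs_le.1 (le_refl |K * a * q|)
        have := abs_le.1 (le_refl |K * T * r|)
        linarith
    have h2 : C * (Z * A) ≤ C ^ 2 * (Z * A) := by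
      gcongr; nlinarith
    have h3 : C * (Z * X) ≤ C ^ 2 * (Z * X) := by
      gcongr; nlinarith
    have h4 : 0 ≤ C ^ 2 * (Z * A) := by positivity
    have h5 : 0 ≤ C ^ 2 * (Z * X) := by positivity
    have h6 : (A + C * X) * (C * Z) = C * (Z * A) + C ^ 2 * (Z * X) := by ring
    linarith
  have hb2 : b ^ 2 ≤ 72 * C ^ 4 * (Z ^ 2 * (A ^ 2 + X ^ 2)) := by
    calc b ^ 2 = |b| ^ 2 := (sq_abs b).symm
      _ ≤ (6 * C ^ 2 * (Z * (A + X))) ^ 2 := by gcongr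
      _ = 36 * C ^ 4 * Z ^ 2 * (A + X) ^ 2 := by ring
      _ ≤ 36 * C ^ 4 * Z ^ 2 * (2 * (A ^ 2 + X ^ 2)) := by
        gcongr; nlinarith [sq_nonneg (A - X)]
      _ = _ := by ring
  -- cross terms
  have c1 : 2 * α * (a * π) ≤ 2 * α ^ 2 * π + 2 * (A * (C * X) * (C * Z)) := by
    have : |α * (a - α) * π| ≤ A * (C * X) * (C * Z) := by
      rw [abs_mul, abs_mul]; gcongr
    have := (abs_le.1 this).2
    linarith [this]
  -- The decisive sign: since q ≥ mZ², this term lowers the square by a multiple of α²Z², up to a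
  -- cross term in AXZ. Nothing else compensates the α²Z² errors.
  have c2 : 2 * K * m * A ^ 2 * Z ^ 2 - 2 * (A * (C * X) * (C * Z)) ≤ 2 * α * (K * a * q) := by
    have h1 : |α * (a - α) * (K * q)| ≤ A * (C * X) * (C * Z) := by
      rw [abs_mul, abs_mul, abs_of_nonneg (by positivity : 0 ≤ K * q)]; gcongr
    have h2 := (abs_le.1 h1).1
    have h3 : K * A ^ 2 * (m * Z ^ 2) ≤ K * A ^ 2 * q := by gcongr
    have h4 : α * (K * a * q) = K * A ^ 2 * q + α * (a - α) * (K * q) := by rw [← hA2]; ring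
    linarith
  have c3 : -(A * (C * Z * X)) ≤ α * (K * T * r) := by
    have : |α * (K * T * r)| ≤ A * (C * Z * X) := by rw [abs_mul]; gcongr
    exact (abs_le.1 this).1
  have hCD1 : C + 4 * C ^ 2 + 4 * C ≤ D := by
    have : C ^ 2 ≤ C ^ 4 := pow_le_pow_right₀ hC (by norm_num)
    have : C ≤ C ^ 4 := le_self_pow₀ hC (by norm_num)
    linarith
  have hCD2 : 72 * C ^ 4 + C ≤ D := by
    have : C ≤ C ^ 4 := le_self_pow₀ hC (by norm_num)
    linarith
  have hCD3 : C ≤ D := by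
    have : C ≤ C ^ 4 := le_self_pow₀ hC (by norm_num)
    linarith
  have k1 : (C + 4 * C ^ 2 + 4 * C) * (A * X * Z) ≤ D * (A * X * Z) := by gcongr
  have k2 : (72 * C ^ 4 + C) * (Z ^ 2 * (A ^ 2 + X ^ 2)) ≤ D * (Z ^ 2 * (A ^ 2 + X ^ 2)) := by
    gcongr
  have k3 : C * Z * X ^ 2 ≤ D * Z * X ^ 2 := by gcongr
  -- Young's inequality, spending half of the available mX²; the other half is spent in `k5`.
  have k4 : D * (A * X * Z) ≤ m / 2 * X ^ 2 + D ^ 2 / (2 * m) * (A * Z) ^ 2 := by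
    have : 0 ≤ (m * X - D * (A * Z)) ^ 2 / (2 * m) := by positivity
    have e : (m * X - D * (A * Z)) ^ 2 / (2 * m) =
      m / 2 * X ^ 2 + D ^ 2 / (2 * m) * (A * Z) ^ 2 - D * (A * X * Z) := by
      field_simp; ring
    linarith
  have k5 : D * Z * X ^ 2 + D * Z ^ 2 * X ^ 2 ≤ m / 2 * X ^ 2 := by
    have : D * Z ^ 2 ≤ D * Z := by
      have : Z ^ 2 ≤ Z := by nlinarith
      gcongr
    have h : D * Z + D * Z ^ 2 ≤ m / 2 := by linarith
    nlinarith [mul_le_mul_of_nonneg_right h (sq_nonneg X)]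
  have k6 : (D + D ^ 2 / (2 * m)) * (A * Z) ^ 2 ≤ 2 * K * m * A ^ 2 * Z ^ 2 := by
    have : 2 * K * m = 2 * D + 2 * (D ^ 2 / m) := by rw [hK]; field_simp
    have h2 : D ^ 2 / (2 * m) = (D ^ 2 / m) / 2 := by field_simp
    have h3 : 0 ≤ D ^ 2 / m := by positivity
    have h4 : D + D ^ 2 / (2 * m) ≤ 2 * K * m := by rw [this, h2]; linarith
    calc _ ≤ 2 * K * m * (A * Z) ^ 2 := by gcongr
      _ = _ := by ring
  have key : (α + b) ^ 2 = α ^ 2 + 2 * α * (a * π) - 2 * α * (K * a * q)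
      - 4 * (α * (K * T * r)) + b ^ 2 := by rw [hb]; ring
  rw [key]
  rw [hA2] at hS c1 ⊢
  linarith

/-! ### Time functions and the geodesic equation -/

section Calibration

open Filter Topology

variable {E : Type*} [NormedAddCommGroup E] [NormedSpace ℝ E]

/-- A curve with nonzero velocity admits a time function depending only on a linear form. -/
lemma exists_time_function {γ γ' : ℝ → E} {ℓ : E →L[ℝ] ℝ}
    (hγ : ∀ᶠ t in 𝓝 (0 : ℝ), HasDerivAt γ (γ' t) t) (hc : ContinuousAt γ' 0)
    (hℓ : ℓ (γ' 0) ≠ 0) :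
    ∃ T : E → ℝ, (∀ᶠ t in 𝓝 0, T (γ t) = t) ∧ ContinuousAt T (γ 0) ∧ T (γ 0) = 0 ∧
      ∀ᶠ x in 𝓝 (γ 0), HasFDerivAt T ((ℓ (γ' (T x)))⁻¹ • ℓ) x := by
  have hf : ∀ᶠ t in 𝓝 (0 : ℝ), HasDerivAt (fun t => ℓ (γ t)) (ℓ (γ' t)) t := by
    filter_upwards [hγ] with t ht using ℓ.hasFDerivAt.comp_hasDerivAt t ht
  have hcd : ContinuousAt (fun t => ℓ (γ' t)) 0 := ℓ.continuous.continuousAt.comp hc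
  have hstrict : HasStrictDerivAt (fun t => ℓ (γ t)) (ℓ (γ' 0)) 0 :=
    hasStrictDerivAt_of_hasDerivAt_of_continuousAt hf hcd
  set e := (hstrict.hasStrictFDerivAt_equiv hℓ).toOpenPartialHomeomorph (fun t => ℓ (γ t)) with he
  have hecoe : ∀ t, e t = ℓ (γ t) := fun t => rfl
  have h0 : (0 : ℝ) ∈ e.source := 
    (hstrict.hasStrictFDerivAt_equiv hℓ).mem_toOpenPartialHomeomorph_source
  have ht0 : ℓ (γ 0) ∈ e.target := by rw [← hecoe]; exact e.map_source h0
  have hsymm0 : e.symm (ℓ (γ 0)) = 0 := by rw [← hecoe]; exact e.left_inv h0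
  have hcont : ContinuousAt e.symm (ℓ (γ 0)) := e.symm.continuousAt ht0
  have hTc : ContinuousAt (fun x => e.symm (ℓ x)) (γ 0) :=
    ContinuousAt.comp (f := fun x => ℓ x) hcont ℓ.continuous.continuousAt
  -- The time at which the curve crosses the level hyperplane of `ℓ` through `x`.
  refine ⟨fun x => e.symm (ℓ x), ?_, hTc, hsymm0, ?_⟩
  · filter_upwards [e.open_source.mem_nhds h0] with t ht
    rw [← hecoe]; exact e.left_inv ht
  · have h1 : ∀ᶠ t in 𝓝 (0 : ℝ), HasDerivAt (fun t => ℓ (γ t)) (ℓ (γ' t)) t ∧ ℓ (γ' t) ≠ 0 :=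
      hf.and (hcd.eventually_ne hℓ)
    have h2 : Tendsto (fun x => e.symm (ℓ x)) (𝓝 (γ 0)) (𝓝 0) := by
      have := hTc.tendsto; simp only [hsymm0] at this; exact this
    have h3 : ∀ᶠ x in 𝓝 (γ 0), ℓ x ∈ e.target :=
      ℓ.continuous.continuousAt.eventually (e.open_target.mem_nhds ht0)
    filter_upwards [h2.eventually h1, h3] with x hx hx3
    have := e.hasDerivAt_symm hx3 hx.2 hx.1
    exact this.comp_hasFDerivAt x ℓ.hasFDerivAt

/-- The geodesic equation of the metric `B` in first-kind form on the set `I` of times, for a curve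
`γ` with velocity `γ'` and acceleration `γ''`. -/
structure IsGeodesicWith (B : E → E →L[ℝ] E →L[ℝ] ℝ) (γ γ' γ'' : ℝ → E) (I : Set ℝ) : Prop where
  hasDerivAt : ∀ t ∈ I, HasDerivAt γ (γ' t) t
  hasDerivAt' : ∀ t ∈ I, HasDerivAt γ' (γ'' t) t
  equation : ∀ t ∈ I, ∀ w,
    B (γ t) (γ'' t) w = - (1 / 2 * koszul B (γ t) (γ' t) (γ' t) w)

variable {B : E → E →L[ℝ] E →L[ℝ] ℝ} {γ γ' γ'' : ℝ → E}

lemma hasDerivAt_comp_normed {F : Type*} [NormedAddCommGroup F] [NormedSpace ℝ F] {f : E → F}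
    {c : ℝ → E} {c' : E} {t : ℝ} (hf : DifferentiableAt ℝ f (c t)) (hc : HasDerivAt c c' t) :
    HasDerivAt (fun t => f (c t)) (fderiv ℝ f (c t) c') t :=
  hf.hasFDerivAt.comp_hasDerivAt t hc

lemma hasDerivAt_clm_apply_normed {F : Type*} [NormedAddCommGroup F] [NormedSpace ℝ F]
    {L : ℝ → E →L[ℝ] F} {L' : E →L[ℝ] F} {c : ℝ → E} {c' : E} {t : ℝ}
    (hL : HasDerivAt L L' t) (hc : HasDerivAt c c' t) :
    HasDerivAt (fun t => L t (c t)) (L' (c t) + L t c') t :=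
  hL.clm_apply hc

lemma IsGeodesicWith.hasDerivAt_momentum {I : Set ℝ} (hg : IsGeodesicWith B γ γ' γ'' I)
    (hB : Differentiable ℝ B) {t : ℝ} (ht : t ∈ I) :
    HasDerivAt (fun t => B (γ t) (γ' t))
      (fderiv ℝ B (γ t) (γ' t) (γ' t) + B (γ t) (γ'' t)) t := by
  have h1 : HasDerivAt (fun t => B (γ t)) (fderiv ℝ B (γ t) (γ' t)) t :=
    hasDerivAt_comp_normed (F := E →L[ℝ] E →L[ℝ] ℝ) (f := B) (hB (γ t)) (hg.hasDerivAt t ht)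
  exact hasDerivAt_clm_apply_normed h1 (hg.hasDerivAt' t ht)

lemma fderiv_bilin_comm (hB : Differentiable ℝ B) (hs : ∀ x u v, B x u v = B x v u)
    (x w u v : E) : fderiv ℝ B x w u v = fderiv ℝ B x w v u := by
  have key : ∀ u v : E, HasFDerivAt (fun y => B y u v) (((fderiv ℝ B x).flip u).flip v) x := by
    intro u v
    convert! ((hB x).hasFDerivAt.clm_apply (hasFDerivAt_const u x)).clm_apply
      (hasFDerivAt_const v x) using 1
    ext z; simp
  have h2 := (key v u).congr_of_eventuallyEq (f₁ := fun y => B y u v)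
    (Eventually.of_forall fun y => hs y u v)
  exact congrArg (fun T => T w) ((key u v).unique h2)

/-- Euler–Lagrange form of the geodesic equation: the Koszul expression at (γ', γ', w) is 2 D_γ'
B(γ', w) - D_w B(γ', γ'), and its first term cancels the derivative of the form along the curve. -/
lemma IsGeodesicWith.momentum_deriv_apply {I : Set ℝ} (hg : IsGeodesicWith B γ γ' γ'' I)
    {t : ℝ} (ht : t ∈ I) (w : E) :
    (fderiv ℝ B (γ t) (γ' t) (γ' t) + B (γ t) (γ'' t)) w =
      1 / 2 * fderiv ℝ B (γ t) w (γ' t) (γ' t) := by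
  rw [add_apply, hg.equation t ht w, koszul]
  ring

lemma IsGeodesicWith.speed_const {ε : ℝ} (hg : IsGeodesicWith B γ γ' γ'' (Set.Ioo (-ε) ε))
    (hB : Differentiable ℝ B) (hs : ∀ x u v, B x u v = B x v u) {t : ℝ}
    (ht : t ∈ Set.Ioo (-ε) ε) :
    B (γ t) (γ' t) (γ' t) = B (γ 0) (γ' 0) (γ' 0) := by
  have hε : 0 < ε := by have := ht.1.trans ht.2; linarith
  have hd : ∀ t ∈ Set.Ioo (-ε) ε, HasDerivAt (fun t => B (γ t) (γ' t) (γ' t)) 0 t := by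
    intro t ht
    have := (hg.hasDerivAt_momentum hB ht).clm_apply (hg.hasDerivAt' t ht)
    convert! this using 1
    rw [hg.momentum_deriv_apply ht, hs, hg.equation t ht, koszul]
    ring
  refine isOpen_Ioo.is_const_of_deriv_eq_zero isPreconnected_Ioo
    (fun t ht => (hd t ht).differentiableAt.differentiableWithinAt)
    (fun t ht => (hd t ht).deriv) ht (by simpa using hε)

end Calibration

/-! ### Calibration of a short geodesic -/

section Calibration

open Filter Topology

variable {E : Type*} [NormedAddCommGroup E] [NormedSpace ℝ E]

set_option maxHeartbeats 1000000 in
/-- The calibration inequality at one point, for bilinear forms close to each other. -/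
lemma calibration_pointwise {N L m K z₀ : ℝ} (hN : 1 ≤ N) (hL : 0 ≤ L)
    (hconst : ∀ α a π q r X Z T S : ℝ, 0 ≤ X → 0 ≤ Z → Z ≤ z₀ → K * |T| ≤ 1 →
      |a - α| ≤ (3 * N ^ 3 + 2 * N ^ 2 * L) * X → |π| ≤ (3 * N ^ 3 + 2 * N ^ 2 * L) * Z →
      m * Z ^ 2 ≤ q → q ≤ (3 * N ^ 3 + 2 * N ^ 2 * L) * Z ^ 2 →
      |r| ≤ (3 * N ^ 3 + 2 * N ^ 2 * L) * Z * X →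
      α ^ 2 + m * X ^ 2 + 2 * α ^ 2 * π - (3 * N ^ 3 + 2 * N ^ 2 * L) * Z * |α| * X
        - (3 * N ^ 3 + 2 * N ^ 2 * L) * Z * X ^ 2
        - (3 * N ^ 3 + 2 * N ^ 2 * L) * Z ^ 2 * (α ^ 2 + X ^ 2) ≤ S →
      (α + (a * π - K * a * q - 2 * (K * T) * r)) ^ 2 ≤ S)
    (Bx By B₀ D : E →L[ℝ] E →L[ℝ] ℝ) (ℓ : E →L[ℝ] ℝ) (v z : E) (t : ℝ)
    (hv : ‖v‖ ≤ N) (hBys : ∀ u w, By u w = By w u) (hDs : ∀ u w, D u w = D w u)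
    (hD : ∀ u w, |D u w| ≤ N * ‖z‖ * ‖u‖ * ‖w‖) (hB₀ : ∀ u w, |B₀ u w| ≤ N * ‖u‖ * ‖w‖)
    (hℓ : ∀ u, |ℓ u| ≤ N * ‖u‖) (hℓv : 1 / 2 ≤ ℓ v) (hunit : By v v = 1)
    (hm₀ : ∀ u, m * ‖u‖ ^ 2 ≤ B₀ u u) (hmy : ∀ u, m * ‖u‖ ^ 2 ≤ By u u)
    (hz : ‖z‖ ≤ z₀) (ht : K * |t| ≤ 1)
    (hT : ∀ u, |Bx u u - By u u - D u u| ≤ L * ‖z‖ ^ 2 * ‖u‖ ^ 2) (u : E) :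
    (By v u + ((ℓ v)⁻¹ * ℓ u * (1 / 2 * D v v) - K * ((ℓ v)⁻¹ * ℓ u) * B₀ z z
      - 2 * (K * t) * B₀ z (u - ((ℓ v)⁻¹ * ℓ u) • v))) ^ 2 ≤ Bx u u := by
  set C := 3 * N ^ 3 + 2 * N ^ 2 * L with hC
  -- Here `ξ` is the part of `u` orthogonal to `v` for `By`, and `a` is the differential of the time
  -- function on `u`. Since `a` and `α` agree when `u` is a multiple of `v`, their difference is
  -- bounded by a multiple of `‖ξ‖`.
  set α := By v u with hα
  set a := (ℓ v)⁻¹ * ℓ u with ha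
  set ξ := u - α • v with hξ
  have hu : u = α • v + ξ := by rw [hξ]; abel
  have hN0 : 0 < N := by linarith
  have hN13 : N ≤ N ^ 3 := le_self_pow₀ hN (by norm_num)
  have hN23 : N ^ 2 ≤ N ^ 3 := pow_le_pow_right₀ hN (by norm_num)
  have hN3 : 0 < N ^ 3 := by positivity
  have hNL : 0 ≤ 2 * N ^ 2 * L := by positivity
  have hC3 : 3 * N ^ 3 ≤ C := by linarith
  have hX : 0 ≤ ‖ξ‖ := norm_nonneg _
  have hZ : 0 ≤ ‖z‖ := norm_nonneg _
  have hℓv0 : 0 < ℓ v := by linarith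
  have hpξ : By v ξ = 0 := by
    rw [hξ, map_sub, map_smul, hunit, smul_eq_mul, mul_one, sub_self]
  have haα : a - α = (ℓ v)⁻¹ * ℓ ξ := by
    rw [ha, hξ, map_sub, map_smul, smul_eq_mul]; field_simp
  have habs : |a - α| ≤ 2 * N * ‖ξ‖ := by
    rw [haα, abs_mul, abs_of_pos (inv_pos.2 hℓv0)]
    have h1 : (ℓ v)⁻¹ ≤ 2 := by
      rw [inv_le_comm₀ hℓv0 (by norm_num)]; linarith
    calc (ℓ v)⁻¹ * |ℓ ξ| ≤ 2 * (N * ‖ξ‖) := by gcongr; exact hℓ ξ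
      _ = _ := by ring
  have hζ : ‖u - a • v‖ ≤ 3 * N ^ 2 * ‖ξ‖ := by
    have : u - a • v = ξ - (a - α) • v := by rw [hξ]; module
    rw [this]
    calc ‖ξ - (a - α) • v‖ ≤ ‖ξ‖ + |a - α| * ‖v‖ := by
          refine (norm_sub_le _ _).trans ?_
          rw [norm_smul, Real.norm_eq_abs]
      _ ≤ ‖ξ‖ + 2 * N * ‖ξ‖ * N := by gcongr
      _ = (1 + 2 * N ^ 2) * ‖ξ‖ := by ring
      _ ≤ 3 * N ^ 2 * ‖ξ‖ := by
        gcongr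
        have : 1 ≤ N ^ 2 := one_le_pow₀ hN
        linarith
  have hunorm : ‖u‖ ^ 2 ≤ 2 * N ^ 2 * (α ^ 2 + ‖ξ‖ ^ 2) := by
    have h1 : ‖u‖ ≤ |α| * N + ‖ξ‖ := by
      conv_lhs => rw [hu]
      refine (norm_add_le _ _).trans ?_
      rw [norm_smul, Real.norm_eq_abs]; gcongr
    have h2 : ‖u‖ ^ 2 ≤ (|α| * N + ‖ξ‖) ^ 2 := by gcongr
    have h3 : (|α| * N + ‖ξ‖) ^ 2 ≤ 2 * (α ^ 2 * N ^ 2 + ‖ξ‖ ^ 2) := by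
      rw [← sq_abs α]; nlinarith [sq_nonneg (|α| * N - ‖ξ‖)]
    have h4 : ‖ξ‖ ^ 2 ≤ N ^ 2 * ‖ξ‖ ^ 2 := by
      have : 1 ≤ N ^ 2 := one_le_pow₀ hN
      nlinarith [sq_nonneg ‖ξ‖]
    linarith
  have hByu : α ^ 2 + m * ‖ξ‖ ^ 2 ≤ By u u := by
    have : By u u = α ^ 2 + By ξ ξ := by
      conv_lhs => rw [hu]
      simp only [map_add, map_smul, add_apply, smul_apply,
        smul_eq_mul, hunit, hpξ, hBys ξ v]
      ring
    rw [this]; linarith [hmy ξ]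
  have hDu : D u u = 2 * α ^ 2 * (1 / 2 * D v v) + 2 * α * D v ξ + D ξ ξ := by
    conv_lhs => rw [hu]
    simp only [map_add, map_smul, add_apply, smul_apply, smul_eq_mul, hDs ξ v]
    ring
  refine hconst α a (1 / 2 * D v v) (B₀ z z) (B₀ z (u - a • v)) ‖ξ‖ ‖z‖ t (Bx u u) hX hZ hz ht
    ?_ ?_ (hm₀ z) ?_ ?_ ?_
  · refine habs.trans ?_
    gcongr; linarith
  · rw [abs_mul, abs_of_pos (by norm_num : (0 : ℝ) < 1 / 2)]
    calc 1 / 2 * |D v v| ≤ 1 / 2 * (N * ‖z‖ * N * N) := by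
          gcongr
          refine (hD v v).trans ?_
          gcongr
      _ = N ^ 3 / 2 * ‖z‖ := by ring
      _ ≤ C * ‖z‖ := by gcongr; linarith
  · calc B₀ z z ≤ N * ‖z‖ * ‖z‖ := (le_abs_self _).trans (hB₀ z z)
      _ = N * ‖z‖ ^ 2 := by ring
      _ ≤ C * ‖z‖ ^ 2 := by gcongr; linarith
  · calc |B₀ z (u - a • v)| ≤ N * ‖z‖ * (3 * N ^ 2 * ‖ξ‖) := by
          refine (hB₀ _ _).trans ?_
          gcongr
      _ = 3 * N ^ 3 * ‖z‖ * ‖ξ‖ := by ring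
      _ ≤ C * ‖z‖ * ‖ξ‖ := by gcongr
  · have h1 := (abs_le.1 (hT u)).1
    have h2 : L * ‖z‖ ^ 2 * ‖u‖ ^ 2 ≤ C * ‖z‖ ^ 2 * (α ^ 2 + ‖ξ‖ ^ 2) := by
      calc L * ‖z‖ ^ 2 * ‖u‖ ^ 2 ≤ L * ‖z‖ ^ 2 * (2 * N ^ 2 * (α ^ 2 + ‖ξ‖ ^ 2)) := by gcongr
        _ = 2 * N ^ 2 * L * ‖z‖ ^ 2 * (α ^ 2 + ‖ξ‖ ^ 2) := by ring
        _ ≤ C * ‖z‖ ^ 2 * (α ^ 2 + ‖ξ‖ ^ 2) := by gcongr; linarith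
    have h3 : |2 * α * D v ξ| ≤ C * ‖z‖ * |α| * ‖ξ‖ := by
      rw [abs_mul, abs_mul, abs_two]
      calc 2 * |α| * |D v ξ| ≤ 2 * |α| * (N * ‖z‖ * N * ‖ξ‖) := by
            gcongr
            refine (hD v ξ).trans ?_
            gcongr
        _ = 2 * N ^ 2 * ‖z‖ * |α| * ‖ξ‖ := by ring
        _ ≤ C * ‖z‖ * |α| * ‖ξ‖ := by gcongr; linarith
    have h4 : |D ξ ξ| ≤ C * ‖z‖ * ‖ξ‖ ^ 2 := by
      calc |D ξ ξ| ≤ N * ‖z‖ * ‖ξ‖ * ‖ξ‖ := hD ξ ξ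
        _ = N * ‖z‖ * ‖ξ‖ ^ 2 := by ring
        _ ≤ C * ‖z‖ * ‖ξ‖ ^ 2 := by gcongr; linarith
    have h5 := (abs_le.1 h3).1
    have h6 := (abs_le.1 h4).1
    linarith

variable {B : E → E →L[ℝ] E →L[ℝ] ℝ} {γ γ' γ'' : ℝ → E}

lemma fderiv_bilin_bound (x w u v : E) :
    |fderiv ℝ B x w u v| ≤ ‖fderiv ℝ B x‖ * ‖w‖ * ‖u‖ * ‖v‖ := by
  calc |fderiv ℝ B x w u v| ≤ ‖fderiv ℝ B x w‖ * ‖u‖ * ‖v‖ :=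
        ContinuousLinearMap.le_opNorm₂ (fderiv ℝ B x w) u v
    _ ≤ _ := by gcongr; exact ContinuousLinearMap.le_opNorm (fderiv ℝ B x) w

set_option maxHeartbeats 1000000 in
/-- A unit speed geodesic is calibrated near each of its points: there is a function `F` of
differential at most `1` which restricts to the time along the geodesic. -/
theorem exists_calibration {ε m : ℝ} (hε : 0 < ε) (hB : ContDiff ℝ 2 B)
    (hs : ∀ x u v, B x u v = B x v u) (hm : 0 < m)
    (hpos : ∀ᶠ x in 𝓝 (γ 0), ∀ u, m * ‖u‖ ^ 2 ≤ B x u u)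
    (hg : IsGeodesicWith B γ γ' γ'' (Set.Ioo (-ε) ε)) (hunit : B (γ 0) (γ' 0) (γ' 0) = 1) :
    ∃ F : E → ℝ, (∀ᶠ t in 𝓝 0, F (γ t) = t) ∧
      ∀ᶠ x in 𝓝 (γ 0), ∃ F' : E →L[ℝ] ℝ, HasFDerivAt F F' x ∧ ∀ u, (F' u) ^ 2 ≤ B x u u := by
  have hBd : Differentiable ℝ B := hB.differentiable (by norm_num)
  have hDc : Continuous (fderiv ℝ B) := hB.continuous_fderiv (by norm_num)
  have h0 : (0 : ℝ) ∈ Set.Ioo (-ε) ε := ⟨by linarith, hε⟩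
  have hI : ∀ᶠ t in 𝓝 (0 : ℝ), t ∈ Set.Ioo (-ε) ε := Ioo_mem_nhds h0.1 h0.2
  have hγc : ContinuousAt γ 0 := (hg.hasDerivAt 0 h0).continuousAt
  have hγ'c : ContinuousAt γ' 0 := (hg.hasDerivAt' 0 h0).continuousAt
  -- The initial momentum defines the time function; unit speed gives `ℓ (γ' 0) = 1`.
  set ℓ := B (γ 0) (γ' 0) with hℓ
  obtain ⟨T, hTγ, hTc, hT0, hTd⟩ := exists_time_function (γ := γ) (γ' := γ') (ℓ := ℓ)
    (by filter_upwards [hI] with t ht using hg.hasDerivAt t ht) hγ'c (by rw [hunit]; norm_num)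
  obtain ⟨L, hL, r, hr, hTay⟩ := exists_taylor_bound (x₀ := γ 0) hB.contDiffAt
  -- The summand 1 makes the bounds strict at the base point, so that they persist nearby.
  set N := 1 + ‖γ' 0‖ + ‖fderiv ℝ B (γ 0)‖ + ‖B (γ 0)‖ + ‖ℓ‖ with hN
  have n1 := norm_nonneg (γ' 0)
  have n2 : 0 ≤ ‖fderiv ℝ B (γ 0)‖ := norm_nonneg _
  have n3 : 0 ≤ ‖B (γ 0)‖ := norm_nonneg _
  have n4 : 0 ≤ ‖ℓ‖ := norm_nonneg _
  have hN1 : 1 ≤ N := by linarith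
  have hC : 1 ≤ 3 * N ^ 3 + 2 * N ^ 2 * L := by
    have : 1 ≤ N ^ 3 := one_le_pow₀ hN1
    have : 0 ≤ 2 * N ^ 2 * L := by positivity
    linarith
  obtain ⟨K, hK, z₀, hz₀, hconst⟩ := exists_calibration_constant hm hC
  -- bounds along the curve
  have hTt : Tendsto T (𝓝 (γ 0)) (𝓝 0) := by
    have := hTc.tendsto; rwa [hT0] at this
  have hγT : Tendsto (fun x => γ (T x)) (𝓝 (γ 0)) (𝓝 (γ 0)) := hγc.tendsto.comp hTt
  have e1 : ∀ᶠ t in 𝓝 (0 : ℝ), ‖γ' t‖ ≤ N := by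
    have : ∀ᶠ t in 𝓝 (0 : ℝ), ‖γ' t‖ < N :=
      hγ'c.norm.eventually_lt_const (by linarith)
    exact this.mono fun _ h => h.le
  have e2 : ∀ᶠ x in 𝓝 (γ 0), ‖fderiv ℝ B x‖ ≤ N := by
    have : ∀ᶠ x in 𝓝 (γ 0), ‖fderiv ℝ B x‖ < N :=
      hDc.norm.continuousAt.eventually_lt_const (by linarith)
    exact this.mono fun _ h => h.le
  have e3 : ∀ᶠ t in 𝓝 (0 : ℝ), 1 / 2 ≤ ℓ (γ' t) := by
    have hc : ContinuousAt (fun t => ℓ (γ' t)) 0 := ℓ.continuous.continuousAt.comp hγ'c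
    have : ∀ᶠ t in 𝓝 (0 : ℝ), 1 / 2 < ℓ (γ' t) :=
      hc.eventually_const_lt (by simp only [hunit]; norm_num)
    exact this.mono fun _ h => h.le
  have e4 : ∀ᶠ x in 𝓝 (γ 0), ‖x - γ (T x)‖ ≤ z₀ := by
    have : Tendsto (fun x => ‖x - γ (T x)‖) (𝓝 (γ 0)) (𝓝 ‖γ 0 - γ 0‖) :=
      (tendsto_id.sub hγT).norm
    rw [sub_self, norm_zero] at this
    exact (this.eventually_lt_const hz₀).mono fun _ h => h.le
  have e5 : ∀ᶠ t in 𝓝 (0 : ℝ), K * |t| ≤ 1 := by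
    have hc : ContinuousAt (fun t : ℝ => K * |t|) 0 := by fun_prop
    have : ∀ᶠ t in 𝓝 (0 : ℝ), K * |t| < 1 := hc.eventually_lt_const (by simp)
    exact this.mono fun _ h => h.le
  have e6 : ∀ᶠ x in 𝓝 (γ 0), x ∈ Metric.ball (γ 0) r := Metric.ball_mem_nhds _ hr
  have hpos0 : ∀ u, m * ‖u‖ ^ 2 ≤ B (γ 0) u u := hpos.self_of_nhds
  -- With z = x - γ(T x), time plus momentum paired with z has the right differential to first order
  -- in z. The correction -K T B₀(z, z) vanishes on the curve and contributes -K B₀(z, z) dT, the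
  -- negative term that beats the second order errors; its other contribution carries the small
  -- factor K T.
  refine ⟨fun x => T x + B (γ (T x)) (γ' (T x)) (x - γ (T x))
    - K * (T x * B (γ 0) (x - γ (T x)) (x - γ (T x))), ?_, ?_⟩
  · filter_upwards [hTγ] with t ht
    simp [ht]
  filter_upwards [hTd, hTt.eventually hI, hTt.eventually e1, hγT.eventually e2, hTt.eventually e3,
    e4, hTt.eventually e5, e6, hγT.eventually e6, hγT.eventually hpos] with x hTd hI e1 e2 e3 e4 e5
    e6 e7 hmy
  have hγx : HasFDerivAt (fun x => γ (T x))
      (((ℓ (γ' (T x)))⁻¹ • ℓ).smulRight (γ' (T x))) x := by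
    have := (hg.hasDerivAt (T x) hI).hasFDerivAt.comp x hTd
    convert! this using 1
  have hpx : HasFDerivAt (fun x => B (γ (T x)) (γ' (T x)))
      (((ℓ (γ' (T x)))⁻¹ • ℓ).smulRight (fderiv ℝ B (γ (T x)) (γ' (T x)) (γ' (T x))
        + B (γ (T x)) (γ'' (T x)))) x := by
    have := (hg.hasDerivAt_momentum hBd hI).hasFDerivAt.comp x hTd
    convert! this using 1
  have hzx : HasFDerivAt (fun x => x - γ (T x)) (ContinuousLinearMap.id ℝ E -
      ((ℓ (γ' (T x)))⁻¹ • ℓ).smulRight (γ' (T x))) x := (hasFDerivAt_id x).sub hγx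
  have hqx := ((hasFDerivAt_const (B (γ 0)) x).clm_apply hzx).clm_apply hzx
  have hF := (hTd.add (hpx.clm_apply hzx)).sub ((hTd.mul hqx).const_mul K)
  refine ⟨_, hF, fun u => ?_⟩
  have hunitx : B (γ (T x)) (γ' (T x)) (γ' (T x)) = 1 := (hg.speed_const hBd hs hI).trans hunit
  have key := calibration_pointwise hN1 hL hconst (B x) (B (γ (T x))) (B (γ 0))
    (fderiv ℝ B (γ (T x)) (x - γ (T x))) ℓ (γ' (T x)) (x - γ (T x)) (T x) e1
    (hs _) (fderiv_bilin_comm hBd hs _ _)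
    (fun u w => (fderiv_bilin_bound _ _ _ _).trans (by gcongr))
    (fun u w => (ContinuousLinearMap.le_opNorm₂ (B (γ 0)) u w).trans (by gcongr; linarith))
    (fun u => (ContinuousLinearMap.le_opNorm ℓ u).trans (by gcongr; linarith))
    e3 hunitx hpos0 hmy e4 e5 (fun u => ?_) u
  · convert! key using 2
    have hmom := hg.momentum_deriv_apply hI (x - γ (T x))
    simp only [add_apply] at hmom
    have hsym := hs (γ 0) (u - ((ℓ (γ' (T x)))⁻¹ * ℓ u) • γ' (T x)) (x - γ (T x))
    -- By unit speed this equals α - a, whose -a cancels the differential of `T`; hence the leading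
    -- part of dF(u) is α.
    have hpu : B (γ (T x)) (γ' (T x)) (u - ((ℓ (γ' (T x)))⁻¹ * ℓ u) • γ' (T x)) =
        B (γ (T x)) (γ' (T x)) u - (ℓ (γ' (T x)))⁻¹ * ℓ u := by
      rw [map_sub, map_smul, hunitx, smul_eq_mul, mul_one]
    simp only [add_apply, sub_apply, smul_apply, ContinuousLinearMap.comp_apply,
      ContinuousLinearMap.flip_apply, ContinuousLinearMap.smulRight_apply, smul_eq_mul,
      ContinuousLinearMap.id_apply, zero_apply, hpu, hsym, hmom]
    ring
  · have h1 : |(B x - B (γ (T x)) - fderiv ℝ B (γ (T x)) (x - γ (T x))) u u| ≤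
        ‖B x - B (γ (T x)) - fderiv ℝ B (γ (T x)) (x - γ (T x))‖ * ‖u‖ * ‖u‖ :=
      ContinuousLinearMap.le_opNorm₂
        (B x - B (γ (T x)) - fderiv ℝ B (γ (T x)) (x - γ (T x))) u u
    have h2 := hTay x e6 (γ (T x)) e7
    calc _ ≤ _ := h1
      _ ≤ L * ‖x - γ (T x)‖ ^ 2 * ‖u‖ * ‖u‖ := by gcongr
      _ = _ := by ring

end Calibration

/-! ### Lengths of paths and local minimality of geodesics -/

section Paths

open Filter Topology MeasureTheory

variable {n : ℕ} {P : (Fin n → ℝ) → Matrix (Fin n) (Fin n) ℝ} {c : ℝ → (Fin n → ℝ)}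

/-- The one-sided derivative is continuous up to the endpoints; the two-sided one in the length
integral may differ from it there, on a null set only. -/
lemma intervalIntegrable_speed_of_contDiffOn (hP : Continuous fun x => matrixBilin (P x)) {a b : ℝ}
    (hab : a ≤ b) (hc : ContDiffOn ℝ 1 c (Set.Icc a b)) :
    IntervalIntegrable (fun s => Real.sqrt (deriv c s ⬝ᵥ (P (c s) *ᵥ deriv c s))) volume a b := by
  rcases hab.eq_or_lt with rfl | hlt
  · exact IntervalIntegrable.refl
  have hd : ContinuousOn (derivWithin c (Set.Icc a b)) (Set.Icc a b) :=
    hc.continuousOn_derivWithin (uniqueDiffOn_Icc hlt) le_rfl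
  have hcont : ContinuousOn (fun s => Real.sqrt (matrixBilin (P (c s))
      (derivWithin c (Set.Icc a b) s) (derivWithin c (Set.Icc a b) s))) (Set.Icc a b) := by
    refine Real.continuous_sqrt.comp_continuousOn ?_
    exact ((hP.comp_continuousOn hc.continuousOn).clm_apply hd).clm_apply hd
  have hint := (hcont.mono (Set.uIcc_of_le hab).subset).intervalIntegrable (μ := volume)
  refine hint.congr_uIoo fun s hs => ?_
  rw [Set.uIoo_of_le hab] at hs
  have : derivWithin c (Set.Icc a b) s = deriv c s :=
    derivWithin_of_mem_nhds (Icc_mem_nhds hs.1 hs.2)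
  simp only [this, matrixBilin_apply]

lemma IsPiecewiseC1On.intervalIntegrable_speed (hP : Continuous fun x => matrixBilin (P x))
    {a b : ℝ} (hc : IsPiecewiseC1On c a b) :
    IntervalIntegrable (fun s => Real.sqrt (deriv c s ⬝ᵥ (P (c s) *ᵥ deriv c s))) volume a b := by
  obtain ⟨k, τ, hτ, rfl, rfl, h⟩ := hc
  exact IntervalIntegrable.trans_iterate fun i hi =>
    intervalIntegrable_speed_of_contDiffOn hP (hτ (Nat.le_succ i)) (h i hi)

lemma IsPiecewiseC1On.continuousOn {a b : ℝ} (hc : IsPiecewiseC1On c a b) :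
    ContinuousOn c (Set.Icc a b) := by
  obtain ⟨k, τ, hτ, rfl, rfl, h⟩ := hc
  have : ∀ i ≤ k, ContinuousOn c (Set.Icc (τ 0) (τ i)) := by
    intro i
    induction i with
    | zero => intro _; simp
    | succ i ih =>
      intro hi
      rw [← Set.Icc_union_Icc_eq_Icc (hτ (Nat.zero_le i)) (hτ (Nat.le_succ i))]
      exact (ih (by omega)).union_of_isClosed (h i (by omega)).continuousOn isClosed_Icc isClosed_Icc
  exact this k le_rfl

lemma IsPiecewiseC1On.mono_right {a b t : ℝ} (hc : IsPiecewiseC1On c a b) (ht : t ∈ Set.Icc a b) :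
    IsPiecewiseC1On c a t := by
  obtain ⟨k, τ, hτ, rfl, rfl, h⟩ := hc
  -- The subdivision is truncated at `t`; pieces beyond `t` collapse to a point.
  refine ⟨k, fun i => min (τ i) t, fun i j hij => min_le_min_right _ (hτ hij), min_eq_left ht.1,
    min_eq_right ht.2, fun i hi => ?_⟩
  rcases le_total (τ i) t with hit | hit
  · refine (h i hi).mono (Set.Icc_subset_Icc ?_ (min_le_left _ _))
    simp [hit]
  · have : min (τ (i + 1)) t = t := min_eq_right (hit.trans (hτ (Nat.le_succ i)))
    simp only [min_eq_right hit, this, Set.Icc_self]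
    exact fun x hx => contDiffWithinAt_singleton.mono (by simp_all)

/-- A function whose differential has norm at most one varies by at most the length of a path. -/
lemma sub_le_pathLength (hP : Continuous fun x => matrixBilin (P x)) {a b : ℝ}
    (hc : IsPiecewiseC1On c a b) {Φ : (Fin n → ℝ) → ℝ}
    (hΦc : ContinuousOn (fun s => Φ (c s)) (Set.Icc a b))
    (hΦ : ∀ s ∈ Set.Ico a b, ∃ Φ' : (Fin n → ℝ) →L[ℝ] ℝ, HasFDerivAt Φ Φ' (c s) ∧
      ∀ u, (Φ' u) ^ 2 ≤ matrixBilin (P (c s)) u u) :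
    Φ (c b) - Φ (c a) ≤ pathLength P c a b := by
  have hint := hc.intervalIntegrable_speed hP
  obtain ⟨k, τ, hτ, rfl, rfl, h⟩ := hc
  have hsub : ∀ i ≤ k, Set.Icc (τ 0) (τ i) ⊆ Set.Icc (τ 0) (τ k) := fun i hi =>
    Set.Icc_subset_Icc_right (hτ hi)
  have key : ∀ i ≤ k, Φ (c (τ i)) - Φ (c (τ 0)) ≤ pathLength P c (τ 0) (τ i) := by
    intro i
    induction i with
    | zero => intro _; simp [pathLength]
    | succ i ih =>
      intro hi
      have hle : τ i ≤ τ (i + 1) := hτ (Nat.le_succ i)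
      have h0i : τ 0 ≤ τ i := hτ (Nat.zero_le i)
      have hIcc : Set.Icc (τ i) (τ (i + 1)) ⊆ Set.Icc (τ 0) (τ k) :=
        Set.Icc_subset_Icc h0i (hτ hi)
      have hpiece := intervalIntegrable_speed_of_contDiffOn hP hle (h i (by omega))
      have hfirst : IntervalIntegrable
          (fun s => Real.sqrt (deriv c s ⬝ᵥ (P (c s) *ᵥ deriv c s))) volume (τ 0) (τ i) := by
        refine hint.mono_set ?_
        rw [Set.uIcc_of_le h0i, Set.uIcc_of_le (hτ (Nat.zero_le k))]
        exact hsub i (by omega)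
      have hstep : Φ (c (τ (i + 1))) - Φ (c (τ i)) ≤ pathLength P c (τ i) (τ (i + 1)) := by
        have hd : ∀ s ∈ Set.Ioo (τ i) (τ (i + 1)),
            HasDerivAt (fun s => Φ (c s)) (fderiv ℝ Φ (c s) (deriv c s)) s ∧
            fderiv ℝ Φ (c s) (deriv c s) ≤
              Real.sqrt (deriv c s ⬝ᵥ (P (c s) *ᵥ deriv c s)) := by
          intro s hs
          obtain ⟨Φ', h1, h2⟩ := hΦ s ⟨h0i.trans hs.1.le, hs.2.trans_le (hτ hi)⟩
          have hcd : DifferentiableAt ℝ c s :=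
            ((h i (by omega)).contDiffAt (Icc_mem_nhds hs.1 hs.2)).differentiableAt (by norm_num)
          rw [h1.fderiv]
          refine ⟨h1.comp_hasDerivAt s hcd.hasDerivAt, Real.le_sqrt_of_sq_le ?_⟩
          rw [← matrixBilin_apply]
          exact h2 _
        refine intervalIntegral.sub_le_integral_of_hasDeriv_right_of_le hle (hΦc.mono hIcc)
          (fun s hs => (hd s hs).1.hasDerivWithinAt) ?_ (fun s hs => (hd s hs).2)
        rw [integrableOn_Icc_iff_integrableOn_Ioc]
        exact (intervalIntegrable_iff_integrableOn_Ioc_of_le hle).1 hpiece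
      have hadd := intervalIntegral.integral_add_adjacent_intervals hfirst hpiece
      have := ih (by omega)
      simp only [pathLength] at this hstep ⊢
      rw [← hadd]
      linarith
  exact key k le_rfl

lemma pathLength_mono_right (hP : Continuous fun x => matrixBilin (P x)) {a b t : ℝ}
    (hc : IsPiecewiseC1On c a b) (ht : t ∈ Set.Icc a b) :
    pathLength P c a t ≤ pathLength P c a b := by
  have hint := hc.intervalIntegrable_speed hP
  refine intervalIntegral.integral_mono_interval le_rfl ht.1 ht.2 ?_ hint
  exact Eventually.of_forall fun s => Real.sqrt_nonneg _

/-- Uniform positivity of a continuous field of positive definite matrices near a point. -/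
lemma exists_eventually_lower_bound (hP : Continuous fun x => matrixBilin (P x))
    {x₀ : Fin n → ℝ} (hpos : (P x₀).PosDef) :
    ∃ m > 0, ∀ᶠ x in 𝓝 x₀, ∀ u, m * ‖u‖ ^ 2 ≤ matrixBilin (P x) u u := by
  have hpos' : ∀ u : Fin n → ℝ, u ≠ 0 → 0 < matrixBilin (P x₀) u u := by
    intro u hu
    rw [matrixBilin_apply]
    simpa using hpos.dotProduct_mulVec_pos hu
  have hbound : ∃ m > 0, ∀ u, m * ‖u‖ ^ 2 ≤ matrixBilin (P x₀) u u := by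
    -- The sphere is empty exactly when n = 0, where any constant works.
    rcases (Metric.sphere (0 : Fin n → ℝ) 1).eq_empty_or_nonempty with he | hne
    · refine ⟨1, one_pos, fun u => ?_⟩
      by_cases hu : u = 0
      · simp [hu]
      · exfalso
        have : ‖u‖⁻¹ • u ∈ Metric.sphere (0 : Fin n → ℝ) 1 := by
          simp [norm_smul, hu]
        rw [he] at this
        exact this
    · have hcont : Continuous fun u : Fin n → ℝ => matrixBilin (P x₀) u u := by fun_prop
      obtain ⟨w, hw, hmin⟩ := (isCompact_sphere (0 : Fin n → ℝ) 1).exists_isMinOn hne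
        hcont.continuousOn
      have hw1 : ‖w‖ = 1 := by simpa using hw
      refine ⟨matrixBilin (P x₀) w w, hpos' w (by rintro rfl; simp at hw1), fun u => ?_⟩
      by_cases hu : u = 0
      · simp [hu]
      have hu' : ‖u‖ ≠ 0 := by simpa using hu
      have hmem : ‖u‖⁻¹ • u ∈ Metric.sphere (0 : Fin n → ℝ) 1 := by
        simp [norm_smul, hu]
      have h1 : matrixBilin (P x₀) w w ≤ matrixBilin (P x₀) (‖u‖⁻¹ • u) (‖u‖⁻¹ • u) := hmin hmem
      simp only [map_smul, smul_apply, smul_eq_mul] at h1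
      calc matrixBilin (P x₀) w w * ‖u‖ ^ 2 ≤
          (‖u‖⁻¹ * (‖u‖⁻¹ * matrixBilin (P x₀) u u)) * ‖u‖ ^ 2 := by gcongr
        _ = _ := by field_simp
  obtain ⟨m, hm, hb⟩ := hbound
  refine ⟨m / 2, by positivity, ?_⟩
  have hc : ContinuousAt (fun x => ‖matrixBilin (P x) - matrixBilin (P x₀)‖) x₀ :=
    (hP.sub continuous_const).norm.continuousAt
  have he : ∀ᶠ x in 𝓝 x₀, ‖matrixBilin (P x) - matrixBilin (P x₀)‖ < m / 2 :=
    hc.eventually_lt_const (by simp only [sub_self, norm_zero]; positivity)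
  filter_upwards [he] with x hx u
  have h1 := ContinuousLinearMap.le_opNorm₂ (matrixBilin (P x) - matrixBilin (P x₀)) u u
  have h2 : ‖(matrixBilin (P x) - matrixBilin (P x₀)) u u‖ ≤ m / 2 * ‖u‖ ^ 2 := by
    refine h1.trans ?_
    rw [mul_assoc, ← sq]
    gcongr
  have h3 := (abs_le.1 h2).1
  simp only [sub_apply] at h3
  have := hb u
  linarith

lemma pathLength_of_unit_speed {γ γ' : ℝ → (Fin n → ℝ)} {s t : ℝ} (hst : s ≤ t)
    (hγ : ∀ r ∈ Set.Icc s t, HasDerivAt γ (γ' r) r)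
    (hunit : ∀ r ∈ Set.Icc s t, matrixBilin (P (γ r)) (γ' r) (γ' r) = 1) :
    pathLength P γ s t = t - s := by
  have : pathLength P γ s t = ∫ _ in s..t, (1 : ℝ) := by
    refine intervalIntegral.integral_congr fun r hr => ?_
    rw [Set.uIcc_of_le hst] at hr
    simp only [(hγ r hr).deriv, ← matrixBilin_apply, hunit r hr, Real.sqrt_one]
  rw [this]; simp

set_option maxHeartbeats 400000 in
/-- Unit speed geodesics are locally minimizing. -/
theorem exists_isMinimizingOn (hPc : ContDiff ℝ 2 fun x => matrixBilin (P x))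
    (hPos : ∀ x, (P x).PosDef) {ε : ℝ} (hε : 0 < ε) {γ γ' γ'' : ℝ → (Fin n → ℝ)}
    (hg : IsGeodesicWith (fun x => matrixBilin (P x)) γ γ' γ'' (Set.Ioo (-ε) ε))
    (hunit : matrixBilin (P (γ 0)) (γ' 0) (γ' 0) = 1) :
    ∃ δ > 0, δ ≤ ε ∧ IsMinimizingOn P γ (Set.Ioo (-δ) δ) := by
  have hP := hPc.continuous
  have hsymm : ∀ x u v, matrixBilin (P x) u v = matrixBilin (P x) v u := fun x u v =>
    matrixBilin_comm (by simpa using (hPos x).isHermitian) u v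
  obtain ⟨m, hm, hmpos⟩ := exists_eventually_lower_bound hP (hPos (γ 0))
  obtain ⟨F, hFγ, hF⟩ := exists_calibration hε hPc hsymm hm hmpos hg hunit
  obtain ⟨ρ', hρ', hball⟩ := Metric.mem_nhds_iff.1 (inter_mem hmpos hF)
  -- Halved so that the closed ball of radius `ρ` still lies in the good neighbourhood.
  set ρ := ρ' / 2 with hρ
  have hρ0 : 0 < ρ := by positivity
  have hball' : ∀ x, ‖x - γ 0‖ ≤ ρ → (∀ u, m * ‖u‖ ^ 2 ≤ matrixBilin (P x) u u) ∧
      ∃ F' : (Fin n → ℝ) →L[ℝ] ℝ, HasFDerivAt F F' x ∧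
        ∀ u, (F' u) ^ 2 ≤ matrixBilin (P x) u u := by
    intro x hx
    refine hball ?_
    rw [mem_ball_iff_norm]; linarith
  have hγc : ContinuousAt γ 0 := (hg.hasDerivAt 0 ⟨by linarith, hε⟩).continuousAt
  have hγρ : ∀ᶠ t in 𝓝 (0 : ℝ), ‖γ t - γ 0‖ < ρ / 2 := by
    have : ContinuousAt (fun t => ‖γ t - γ 0‖) 0 := (hγc.sub continuousAt_const).norm
    exact this.eventually_lt_const (by simp only [sub_self, norm_zero]; positivity)
  obtain ⟨δ₁, hδ₁, hδball⟩ := Metric.mem_nhds_iff.1 (inter_mem hFγ hγρ)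
  -- The last bound gives t - s ≤ 2δ ≤ √m ρ / 2, the least cost of a path that leaves the ball of
  -- radius `ρ`.
  set δ := min (min ε δ₁) (Real.sqrt m * ρ / 4) with hδ
  have hsm : 0 < Real.sqrt m := Real.sqrt_pos.2 hm
  have hδ0 : 0 < δ := by positivity
  have hδε : δ ≤ ε := (min_le_left _ _).trans (min_le_left _ _)
  have hδδ₁ : δ ≤ δ₁ := (min_le_left _ _).trans (min_le_right _ _)
  have hδρ : δ ≤ Real.sqrt m * ρ / 4 := min_le_right _ _
  have hnear : ∀ t ∈ Set.Ioo (-δ) δ, F (γ t) = t ∧ ‖γ t - γ 0‖ < ρ / 2 := by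
    intro t ht
    refine hδball ?_
    rw [mem_ball_iff_norm, sub_zero, Real.norm_eq_abs, abs_lt]
    exact ⟨by linarith [ht.1], by linarith [ht.2]⟩
  refine ⟨δ, hδ0, hδε, fun s hs t ht hst => ?_⟩
  have hsub : Set.Icc s t ⊆ Set.Ioo (-ε) ε := fun r hr =>
    ⟨by linarith [hs.1, hr.1], by linarith [ht.2, hr.2]⟩
  have hlen : pathLength P γ s t = t - s :=
    pathLength_of_unit_speed hst (fun r hr => hg.hasDerivAt r (hsub hr)) fun r hr =>
      (hg.speed_const (hPc.differentiable (by norm_num)) hsymm (hsub hr)).trans hunit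
  have hlower : ∀ (a b : ℝ) (c : ℝ → (Fin n → ℝ)), a ≤ b → IsPiecewiseC1On c a b → c a = γ s →
      c b = γ t → t - s ≤ pathLength P c a b := by
    intro a b c hab hc hca hcb
    have hcc := hc.continuousOn
    -- A competitor inside the ball is controlled by the calibration; any other is already too long
    -- at its first exit time `t₁`.
    by_cases hin : ∀ r ∈ Set.Icc a b, ‖c r - γ 0‖ < ρ
    · have := sub_le_pathLength hP hc (Φ := F)
        (fun r hr => by
          obtain ⟨F', hF', -⟩ := (hball' (c r) (hin r hr).le).2
          exact ContinuousAt.comp_continuousWithinAt (f := c) hF'.continuousAt (hcc r hr))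
        (fun r hr => (hball' (c r) (hin r ⟨hr.1, hr.2.le⟩).le).2)
      rwa [hca, hcb, (hnear s hs).1, (hnear t ht).1] at this
    · push Not at hin
      obtain ⟨r₀, hr₀, hr₀'⟩ := hin
      have hcl : IsCompact (Set.Icc a b ∩ (fun r => ‖c r - γ 0‖) ⁻¹' Set.Ici ρ) :=
        isCompact_Icc.of_isClosed_subset
          (ContinuousOn.preimage_isClosed_of_isClosed (hcc.sub continuousOn_const).norm
            isClosed_Icc isClosed_Ici) Set.inter_subset_left
      obtain ⟨t₁, ⟨ht₁, ht₁'⟩, hleast⟩ := hcl.exists_isLeast ⟨r₀, hr₀, hr₀'⟩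
      have hbefore : ∀ r ∈ Set.Ico a t₁, ‖c r - γ 0‖ ≤ ρ := by
        intro r hr
        by_contra hcon
        push Not at hcon
        exact absurd (hleast ⟨⟨hr.1, hr.2.le.trans ht₁.2⟩, hcon.le⟩) (not_le.2 hr.2)
      -- The norm is the sup norm, so one coordinate alone realizes the exit. That coordinate, times
      -- ±√m, has differential at most 1 for the metric in the ball and bounds the length from
      -- below.
      have hcoord : ∃ i, ρ ≤ |c t₁ i - γ 0 i| := by
        by_contra hcon
        push Not at hcon
        have : ‖c t₁ - γ 0‖ < ρ := (pi_norm_lt_iff hρ0).2 fun i => by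
          simpa [Real.norm_eq_abs] using hcon i
        exact absurd ht₁' (not_le.2 this)
      obtain ⟨i, hi⟩ := hcoord
      have hsi : |c a i - γ 0 i| < ρ / 2 := by
        rw [hca]
        refine lt_of_le_of_lt ?_ (hnear s hs).2
        simpa [Real.norm_eq_abs] using norm_le_pi_norm (γ s - γ 0) i
      obtain ⟨σ, hσ, hσi⟩ : ∃ σ : ℝ, σ ^ 2 = 1 ∧ |c t₁ i - γ 0 i| = σ * (c t₁ i - γ 0 i) := by
        rcases abs_choice (c t₁ i - γ 0 i) with h | h
        · exact ⟨1, by norm_num, by rw [one_mul, h]⟩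
        · exact ⟨-1, by norm_num, by rw [h]; ring⟩
      have hσabs : |σ| = 1 := by
        rw [← Real.sqrt_sq_eq_abs, hσ, Real.sqrt_one]
      set Φ : (Fin n → ℝ) →L[ℝ] ℝ := (Real.sqrt m * σ) • ContinuousLinearMap.proj i with hΦ
      have hΦa : ∀ x, Φ x = Real.sqrt m * σ * x i := fun x => by simp [hΦ]
      have hc₁ := hc.mono_right ht₁
      have h1 := sub_le_pathLength hP hc₁ (Φ := Φ)
        (Φ.continuous.comp_continuousOn hc₁.continuousOn)
        (fun r hr => ⟨Φ, Φ.hasFDerivAt, fun u => by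
          refine le_trans ?_ ((hball' (c r) (hbefore r hr)).1 u)
          rw [hΦa, mul_pow, mul_pow, hσ, Real.sq_sqrt hm.le, mul_one, ← sq_abs]
          gcongr
          exact norm_le_pi_norm u i⟩)
      have h2 := pathLength_mono_right hP hc ht₁
      rw [hΦa, hΦa] at h1
      have h3 : ρ / 2 ≤ σ * (c t₁ i - c a i) := by
        have e : σ * (c t₁ i - c a i) = σ * (c t₁ i - γ 0 i) - σ * (c a i - γ 0 i) := by ring
        have h4 : σ * (c a i - γ 0 i) ≤ |c a i - γ 0 i| := by
          refine (le_abs_self _).trans ?_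
          rw [abs_mul, hσabs, one_mul]
        rw [e, ← hσi]; linarith
      have h5 : Real.sqrt m * (ρ / 2) ≤ Real.sqrt m * (σ * (c t₁ i - c a i)) := by gcongr
      have h6 : t - s ≤ 2 * δ := by linarith [hs.1, ht.2]
      linarith
  have hmem : t - s ∈ {L : ℝ | ∃ (a b : ℝ) (c : ℝ → (Fin n → ℝ)), a ≤ b ∧ IsPiecewiseC1On c a b ∧
      c a = γ s ∧ c b = γ t ∧ L = pathLength P c a b} := by
    refine ⟨s, t, γ, hst, ⟨1, fun i => if i = 0 then s else t, ?_, by simp, by simp, ?_⟩, rfl, rfl,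
      hlen.symm⟩
    · intro i j hij
      by_cases hj : j = 0
      · have : i = 0 := by omega
        simp [hj, this]
      · by_cases hi : i = 0 <;> simp [hi, hj, hst]
    · intro i hi
      have : i = 0 := by omega
      subst this
      simp only [zero_add, one_ne_zero, if_true, if_false]
      have hγC1 : ContDiffOn ℝ 1 γ (Set.Ioo (-ε) ε) := by
        rw [contDiffOn_one_iff_derivWithin (uniqueDiffOn_Ioo _ _)]
        refine ⟨fun r hr => (hg.hasDerivAt r hr).differentiableAt.differentiableWithinAt, ?_⟩
        have : Set.EqOn (derivWithin γ (Set.Ioo (-ε) ε)) γ' (Set.Ioo (-ε) ε) := fun r hr => by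
          rw [derivWithin_of_isOpen isOpen_Ioo hr, (hg.hasDerivAt r hr).deriv]
        refine ContinuousOn.congr (fun r hr => ?_) this
        exact (hg.hasDerivAt' r hr).continuousAt.continuousWithinAt
      exact hγC1.mono hsub
  rw [hlen]
  refine le_antisymm (le_csInf ⟨_, hmem⟩ ?_) (csInf_le ⟨t - s, ?_⟩ hmem)
  · rintro L ⟨a, b, c, hab, hc, hca, hcb, rfl⟩
    exact hlower a b c hab hc hca hcb
  · rintro L ⟨a, b, c, hab, hc, hca, hcb, rfl⟩
    exact hlower a b c hab hc hca hcb

end Paths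

/-! ### Smoothness of determinants, inverses and products -/

section MatrixRegularity

variable {E : Type*} [NormedAddCommGroup E] [NormedSpace ℝ E] {r : WithTop ℕ∞} {x : E}

lemma contDiffAt_det {m : ℕ} {A : E → Matrix (Fin m) (Fin m) ℝ}
    (hA : ∀ i j, ContDiffAt ℝ r (fun y => A y i j) x) :
    ContDiffAt ℝ r (fun y => (A y).det) x := by
  simp only [Matrix.det_apply]
  exact ContDiffAt.sum fun σ _ => (contDiffAt_prod fun i _ => hA _ _).const_smul _

/-- Cramer's rule: each entry of the inverse is a quotient of two determinants. -/
lemma contDiffAt_matrix_inv {m : ℕ} {A : E → Matrix (Fin m) (Fin m) ℝ}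
    (hA : ∀ i j, ContDiffAt ℝ r (fun y => A y i j) x) (hdet : (A x).det ≠ 0) (i j : Fin m) :
    ContDiffAt ℝ r (fun y => (A y)⁻¹ i j) x := by
  have h1 : (fun y => (A y)⁻¹ i j) = fun y => ((A y).det)⁻¹ *
      ((A y).updateRow j (Pi.single i 1)).det := by
    funext y
    rw [Matrix.inv_def, Ring.inverse_eq_inv', Matrix.smul_apply, smul_eq_mul,
      Matrix.adjugate_apply]
  rw [h1]
  refine ((contDiffAt_det hA).inv hdet).mul (contDiffAt_det fun k l => ?_)
  by_cases hk : k = j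
  · subst hk
    simp only [Matrix.updateRow_self]
    exact contDiffAt_const
  · simp only [Matrix.updateRow_ne hk]
    exact hA k l

lemma contDiffAt_matrix_mul {l m k : ℕ} {A : E → Matrix (Fin l) (Fin m) ℝ}
    {C : E → Matrix (Fin m) (Fin k) ℝ}
    (hA : ∀ i j, ContDiffAt ℝ r (fun y => A y i j) x)
    (hC : ∀ i j, ContDiffAt ℝ r (fun y => C y i j) x) (i : Fin l) (j : Fin k) :
    ContDiffAt ℝ r (fun y => (A y * C y) i j) x := by
  simp only [Matrix.mul_apply]
  exact ContDiffAt.sum fun σ _ => (hA _ _).mul (hC _ _)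

end MatrixRegularity

/-! ### The Jacobian and the Fréchet derivative -/

section Jacobian

variable {n p : ℕ} {r : WithTop ℕ∞} {x : Fin n → ℝ}

lemma contDiffAt_partialDeriv {f : (Fin n → ℝ) → ℝ} {s : WithTop ℕ∞} (hf : ContDiffAt ℝ s f x)
    (hr : r + 1 ≤ s) (a : Fin n) : ContDiffAt ℝ r (partialDeriv a f) x :=
  (hf.fderiv_right hr).clm_apply contDiffAt_const

lemma contDiffAt_jacobian {h : (Fin n → ℝ) → (Fin p → ℝ)} {s : WithTop ℕ∞}
    (hh : ContDiffAt ℝ s h x) (hr : r + 1 ≤ s) (i : Fin p) (a : Fin n) :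
    ContDiffAt ℝ r (fun y => jacobian h y i a) x :=
  contDiffAt_partialDeriv (contDiffAt_pi.1 hh i) hr a

lemma fderiv_component {h : (Fin n → ℝ) → (Fin p → ℝ)} (hh : DifferentiableAt ℝ h x) (i : Fin p)
    (v : Fin n → ℝ) : fderiv ℝ (fun z => h z i) x v = fderiv ℝ h x v i := by
  have := (hasFDerivAt_pi'.1 hh.hasFDerivAt i).fderiv
  rw [this]; rfl

lemma jacobian_mulVec {h : (Fin n → ℝ) → (Fin p → ℝ)} (hh : DifferentiableAt ℝ h x)
    (v : Fin n → ℝ) : jacobian h x *ᵥ v = fderiv ℝ h x v := by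
  funext i
  rw [← fderiv_component hh]
  conv_rhs => rw [← Finset.univ_sum_single v, map_sum]
  simp only [Matrix.mulVec, dotProduct, jacobian, Matrix.of_apply, partialDeriv]
  refine Finset.sum_congr rfl fun e _ => ?_
  have : (Pi.single e (v e) : Fin n → ℝ) = v e • Pi.single e 1 := by
    rw [← Pi.single_smul]; simp
  rw [this, map_smul, smul_eq_mul, mul_comm]

end Jacobian

/-! ### Existence of geodesics and maximal minimizing extensions -/

section Geodesics

open Filter Topology

variable {n : ℕ} {P : (Fin n → ℝ) → Matrix (Fin n) (Fin n) ℝ}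

lemma contDiff_christoffel (hP : ∀ a b, ContDiff ℝ 2 fun x => P x a b)
    (hPos : ∀ x, (P x).PosDef) (c a b : Fin n) : ContDiff ℝ 1 (christoffel P c a b) := by
  rw [contDiff_iff_contDiffAt]
  intro x
  have hd : ∀ a b e, ContDiffAt ℝ 1 (partialDeriv e fun z => P z a b) x := fun a b e =>
    contDiffAt_partialDeriv (hP a b).contDiffAt (by norm_num) e
  have hinv : ∀ a b, ContDiffAt ℝ 1 (fun y => (P y)⁻¹ a b) x :=
    contDiffAt_matrix_inv (fun a b => ((hP a b).of_le (by norm_num)).contDiffAt)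
      (hPos x).det_pos.ne'
  exact contDiffAt_const.mul (ContDiffAt.sum fun d _ =>
    (hinv c d).mul (((hd a d b).add (hd b d a)).sub (hd a b d)))

/-- Local existence of geodesics with prescribed initial position and velocity. -/
theorem exists_geodesic (hP : ∀ a b, ContDiff ℝ 2 fun x => P x a b)
    (hPos : ∀ x, (P x).PosDef) (x₀ v : Fin n → ℝ) :
    ∃ ε > 0, ∃ γ γ' γ'' : ℝ → (Fin n → ℝ), γ 0 = x₀ ∧ γ' 0 = v ∧
      IsGeodesicWith (fun x => matrixBilin (P x)) γ γ' γ'' (Set.Ioo (-ε) ε) ∧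
      IsGeodesicOn P γ (Set.Ioo (-ε) ε) := by
  set A : (Fin n → ℝ) × (Fin n → ℝ) → (Fin n → ℝ) := fun q c =>
    -∑ a, ∑ b, christoffel P c a b q.1 * q.2 a * q.2 b with hA
  have hAc : ContDiff ℝ 1 A := by
    refine contDiff_pi.2 fun c => ?_
    refine (ContDiff.sum fun a _ => ContDiff.sum fun b _ => ?_).neg
    have h1 := (contDiff_christoffel hP hPos c a b).comp
      (contDiff_fst (E := Fin n → ℝ) (F := Fin n → ℝ))
    have h2 : ∀ a : Fin n, ContDiff ℝ 1 fun q : (Fin n → ℝ) × (Fin n → ℝ) => q.2 a := fun a => by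
      fun_prop
    exact (h1.mul (h2 a)).mul (h2 b)
  -- The geodesic equation as a first order system in position and velocity; a C² metric makes it
  -- C¹, which suffices for local existence.
  have hf : ContDiffAt ℝ 1 (fun q : (Fin n → ℝ) × (Fin n → ℝ) => (q.2, A q)) (x₀, v) :=
    (contDiff_snd.prodMk hAc).contDiffAt
  obtain ⟨α, hα0, ε, hε, hα⟩ :=
    hf.exists_forall_mem_closedBall_exists_eq_forall_mem_Ioo_hasDerivAt₀ 0
  simp only [zero_sub, zero_add] at hα
  have hγ : ∀ t ∈ Set.Ioo (-ε) ε, HasDerivAt (fun t => (α t).1) (α t).2 t := fun t ht =>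
    (hasFDerivAt_fst (𝕜 := ℝ) (p := α t)).comp_hasDerivAt t (hα t ht)
  have hγ' : ∀ t ∈ Set.Ioo (-ε) ε, HasDerivAt (fun t => (α t).2) (A (α t)) t := fun t ht =>
    (hasFDerivAt_snd (𝕜 := ℝ) (p := α t)).comp_hasDerivAt t (hα t ht)
  have hd1 : Set.EqOn (deriv fun t => (α t).1) (fun t => (α t).2) (Set.Ioo (-ε) ε) :=
    fun t ht => (hγ t ht).deriv
  have hd2 : ∀ t ∈ Set.Ioo (-ε) ε, deriv (deriv fun t => (α t).1) t = A (α t) := fun t ht => by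
    rw [(hd1.eventuallyEq_of_mem (isOpen_Ioo.mem_nhds ht)).deriv_eq]
    exact (hγ' t ht).deriv
  refine ⟨ε, hε, fun t => (α t).1, fun t => (α t).2, fun t => A (α t), by simp [hα0],
    by simp [hα0], ⟨hγ, hγ', fun t _ w => ?_⟩, ?_, fun t ht c => ?_⟩
  · have h1 := sum_christoffel_mul (M := P) (x := (α t).1)
      (fun i j => ((hP i j).differentiable (by norm_num)) _)
      (by simpa using (hPos (α t).1).isHermitian) (hPos (α t).1).det_pos.ne'.isUnit
      (α t).2 (α t).2 w
    rw [← h1, matrixBilin_apply]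
    simp only [dotProduct, hA, neg_mul, Finset.sum_neg_distrib]
  · have h3 : (2 : WithTop ℕ∞) = 1 + 1 := by norm_num
    rw [h3, contDiffOn_succ_iff_deriv_of_isOpen isOpen_Ioo]
    refine ⟨fun t ht => (hγ t ht).differentiableAt.differentiableWithinAt, by simp, ?_⟩
    refine ContDiffOn.congr ?_ hd1
    rw [← zero_add (1 : WithTop ℕ∞), contDiffOn_succ_iff_deriv_of_isOpen isOpen_Ioo]
    refine ⟨fun t ht => (hγ' t ht).differentiableAt.differentiableWithinAt, by simp, ?_⟩
    rw [contDiffOn_zero]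
    refine ContinuousOn.congr (f := fun t => A (α t)) ?_ fun t ht => (hγ' t ht).deriv
    exact hAc.continuous.comp_continuousOn fun t ht => (hα t ht).continuousAt.continuousWithinAt
  · rw [hd2 t ht, hd1 ht]

lemma IsGeodesicOn.mono {γ : ℝ → (Fin n → ℝ)} {I J : Set ℝ} (hγ : IsGeodesicOn P γ J)
    (hIJ : I ⊆ J) : IsGeodesicOn P γ I :=
  ⟨hγ.1.mono hIJ, fun s hs => hγ.2 s (hIJ hs)⟩

lemma pathLength_congr {γ γ' : ℝ → (Fin n → ℝ)} {I : Set ℝ} (hI : IsOpen I)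
    (hord : I.OrdConnected) (h : Set.EqOn γ γ' I) {s t : ℝ} (hs : s ∈ I) (ht : t ∈ I) :
    pathLength P γ s t = pathLength P γ' s t := by
  refine intervalIntegral.integral_congr fun r hr => ?_
  have hrI : r ∈ I := hord.uIcc_subset hs ht hr
  have hd : deriv γ r = deriv γ' r :=
    (h.eventuallyEq_of_mem (hI.mem_nhds hrI)).deriv_eq
  simp only [hd, h hrI]

lemma IsMinimizingGeodesicIn.congr {Ω : Set (Fin n → ℝ)} {γ γ' : ℝ → (Fin n → ℝ)} {I : Set ℝ}
    (hγ : IsMinimizingGeodesicIn P Ω γ I) (h : Set.EqOn γ γ' I) :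
    IsMinimizingGeodesicIn P Ω γ' I := by
  obtain ⟨hI, hord, hne, ⟨hC, hgeo⟩, hmin, hmaps⟩ := hγ
  refine ⟨hI, hord, hne, ⟨hC.congr h.symm, fun s hs c => ?_⟩, fun s hs t ht hst => ?_,
    fun s hs => h hs ▸ hmaps hs⟩
  · have e : γ =ᶠ[𝓝 s] γ' := h.eventuallyEq_of_mem (hI.mem_nhds hs)
    rw [← e.deriv_eq, ← e.deriv.deriv_eq, ← h hs]
    exact hgeo s hs c
  · rw [← pathLength_congr hI hord h hs ht, ← h hs, ← h ht]
    exact hmin s hs t ht hst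

/-- Every requirement is local or involves only two times, and by directedness two times lie in a
common member of the family. -/
lemma isMinimizingGeodesicIn_sUnion {Ω : Set (Fin n → ℝ)} {γ : ℝ → (Fin n → ℝ)}
    {S : Set (Set ℝ)} (hne : S.Nonempty) (hdir : DirectedOn (· ⊆ ·) S)
    (hS : ∀ I ∈ S, IsMinimizingGeodesicIn P Ω γ I) :
    IsMinimizingGeodesicIn P Ω γ (⋃₀ S) := by
  have hpair : ∀ s ∈ ⋃₀ S, ∀ t ∈ ⋃₀ S, ∃ I ∈ S, s ∈ I ∧ t ∈ I := by
    rintro s ⟨I, hI, hs⟩ t ⟨J, hJ, ht⟩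
    obtain ⟨K, hK, hIK, hJK⟩ := hdir I hI J hJ
    exact ⟨K, hK, hIK hs, hJK ht⟩
  refine ⟨isOpen_sUnion fun I hI => (hS I hI).1, ⟨fun s hs t ht r hr => ?_⟩, ?_,
    ⟨fun s hs => ?_, fun s hs c => ?_⟩, fun s hs t ht hst => ?_, fun s hs => ?_⟩
  · obtain ⟨I, hI, hsI, htI⟩ := hpair s hs t ht
    exact ⟨I, hI, (hS I hI).2.1.out hsI htI hr⟩
  · obtain ⟨I, hI⟩ := hne
    obtain ⟨s, hs⟩ := (hS I hI).2.2.1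
    exact ⟨s, I, hI, hs⟩
  · obtain ⟨I, hI, hsI⟩ := hs
    exact (((hS I hI).2.2.2.1.1 s hsI).contDiffAt
      ((hS I hI).1.mem_nhds hsI)).contDiffWithinAt
  · obtain ⟨I, hI, hsI⟩ := hs
    exact (hS I hI).2.2.2.1.2 s hsI c
  · obtain ⟨I, hI, hsI, htI⟩ := hpair s hs t ht
    exact (hS I hI).2.2.2.2.1 s hsI t htI hst
  · obtain ⟨I, hI, hsI⟩ := hs
    exact (hS I hI).2.2.2.2.2 hsI

/-- Every minimizing geodesic in `Ω` extends to a maximal one. -/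
theorem exists_maximal_extension {Ω : Set (Fin n → ℝ)} {γ₀ : ℝ → (Fin n → ℝ)} {I₀ : Set ℝ}
    (h₀ : IsMinimizingGeodesicIn P Ω γ₀ I₀) :
    ∃ γ I, I₀ ⊆ I ∧ Set.EqOn γ₀ γ I₀ ∧ IsMaximalMinimizingGeodesicIn P Ω γ I := by
  classical
  let X := {q : (ℝ → (Fin n → ℝ)) × Set ℝ //
    IsMinimizingGeodesicIn P Ω q.1 q.2 ∧ I₀ ⊆ q.2 ∧ Set.EqOn γ₀ q.1 I₀}
  -- Curves are total functions whose values off the interval are irrelevant, so this is a preorder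
  -- that need not be antisymmetric; Zorn's lemma is applied in that form.
  let r : X → X → Prop := fun q q' => q.1.2 ⊆ q'.1.2 ∧ Set.EqOn q.1.1 q'.1.1 q.1.2
  have htrans : ∀ {a b c : X}, r a b → r b c → r a c := fun hab hbc =>
    ⟨hab.1.trans hbc.1, hab.2.trans (hbc.2.mono hab.1)⟩
  have hub : ∀ C : Set X, IsChain r C → ∃ ub, ∀ a ∈ C, r a ub := by
    intro C hC
    rcases C.eq_empty_or_nonempty with rfl | ⟨q₀, hq₀⟩
    · exact ⟨⟨(γ₀, I₀), h₀, subset_rfl, Set.eqOn_refl _ _⟩, by simp⟩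
    have hrefl : ∀ q : X, r q q := fun q => ⟨subset_rfl, Set.eqOn_refl _ _⟩
    have hcmp : ∀ q ∈ C, ∀ q' ∈ C, r q q' ∨ r q' q := fun q hq q' hq' => by
      by_cases he : q = q'
      · subst he; exact Or.inl (hrefl q)
      · exact hC hq hq' he
    -- Gluing of the chain; the default value 0 lies outside the union of the intervals and plays no
    -- role.
    let Γ : ℝ → (Fin n → ℝ) := fun t =>
      if h : ∃ q ∈ C, t ∈ q.1.2 then h.choose.1.1 t else 0
    have hΓ : ∀ q ∈ C, Set.EqOn q.1.1 Γ q.1.2 := by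
      intro q hq t ht
      have h : ∃ q ∈ C, t ∈ q.1.2 := ⟨q, hq, ht⟩
      have hch := h.choose_spec
      have : Γ t = h.choose.1.1 t := dif_pos h
      rw [this]
      rcases hcmp q hq _ hch.1 with h' | h'
      · exact h'.2 ht
      · exact (h'.2 hch.2).symm
    have hmin : IsMinimizingGeodesicIn P Ω Γ (⋃₀ ((fun q : X => q.1.2) '' C)) := by
      refine isMinimizingGeodesicIn_sUnion ⟨_, q₀, hq₀, rfl⟩ ?_ ?_
      · rintro _ ⟨q, hq, rfl⟩ _ ⟨q', hq', rfl⟩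
        rcases hcmp q hq q' hq' with h' | h'
        · exact ⟨_, ⟨q', hq', rfl⟩, h'.1, subset_rfl⟩
        · exact ⟨_, ⟨q, hq, rfl⟩, subset_rfl, h'.1⟩
      · rintro _ ⟨q, hq, rfl⟩
        exact q.2.1.congr (hΓ q hq)
    have hsub : ∀ q ∈ C, q.1.2 ⊆ ⋃₀ ((fun q : X => q.1.2) '' C) := fun q hq =>
      Set.subset_sUnion_of_mem ⟨q, hq, rfl⟩
    refine ⟨⟨(Γ, ⋃₀ ((fun q : X => q.1.2) '' C)), hmin, q₀.2.2.1.trans (hsub q₀ hq₀),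
      q₀.2.2.2.trans ((hΓ q₀ hq₀).mono q₀.2.2.1)⟩, fun q hq => ⟨hsub q hq, hΓ q hq⟩⟩
  obtain ⟨m, hm⟩ := exists_maximal_of_chains_bounded hub htrans
  refine ⟨m.1.1, m.1.2, m.2.2.1, m.2.2.2, m.2.1, fun γ' I' h' hsub heq => ?_⟩
  exact Set.Subset.antisymm (hm ⟨(γ', I'), h', m.2.2.1.trans hsub,
    m.2.2.2.trans (heq.mono m.2.2.1)⟩ ⟨hsub, heq⟩).1 hsub

end Geodesics

/-! ### Level sets of a geodesically monotone map are totally geodesic -/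

section Monotone

open Filter Topology

variable {n p : ℕ} {P : (Fin n → ℝ) → Matrix (Fin n) (Fin n) ℝ} {h : (Fin n → ℝ) → (Fin p → ℝ)}
  {Ω : Set (Fin n → ℝ)}

/-- A geodesically monotone map is constant along a minimizing geodesic whose velocity at one time
is tangent to its level set. -/
lemma GeodesicallyMonotone.eq_of_tangent (hmono : GeodesicallyMonotone P h Ω)
    {γ : ℝ → (Fin n → ℝ)} {δ : ℝ}
    (hγ : IsMinimizingGeodesicIn P Ω γ (Set.Ioo (-δ) δ))
    (hd : HasDerivAt (fun t => h (γ t)) 0 0) {t : ℝ} (ht : t ∈ Set.Ioo (-δ) δ) :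
    h (γ t) = h (γ 0) := by
  have hδ : 0 < δ := by have := ht.1.trans ht.2; linarith
  obtain ⟨γm, I, hI, heq, hmax⟩ := exists_maximal_extension hγ
  obtain ⟨w, hw, -, -, hder⟩ := hmono
  have h0 : (0 : ℝ) ∈ Set.Ioo (-δ) δ := ⟨by linarith, hδ⟩
  have hdm : HasDerivAt (fun t => h (γm t)) 0 0 :=
    hd.congr_of_eventuallyEq (by
      filter_upwards [Ioo_mem_nhds h0.1 h0.2] with s hs using by rw [heq hs])
  have key : ∀ s₃ ∈ Set.Ioo (-δ) 0, ∀ s₄ ∈ Set.Ioo 0 δ, h (γ s₃) = h (γ s₄) := by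
    intro s₃ hs₃ s₄ hs₄
    have m₃ : s₃ ∈ Set.Ioo (-δ) δ := ⟨hs₃.1, hs₃.2.trans hδ⟩
    have m₄ : s₄ ∈ Set.Ioo (-δ) δ := ⟨h0.1.trans hs₄.1, hs₄.2⟩
    by_contra hne
    rw [heq m₃, heq m₄] at hne
    -- Monotonicity at the interior time 0 contradicts the chain rule, since h ∘ γ has zero velocity
    -- there.
    have := hder γm I hmax s₃ (hI m₃) s₄ (hI m₄) (hs₃.2.trans hs₄.1) hne 0 ⟨hs₃.2, hs₄.1⟩
    have hpair : HasDerivAt (fun t => (h (γm t), h (γm s₃)))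
        ((0, 0) : (Fin p → ℝ) × (Fin p → ℝ)) 0 := hdm.prodMk (hasDerivAt_const _ _)
    have hcomp := ((hw.differentiable (by norm_num)) (h (γm 0), h (γm s₃))).hasFDerivAt.comp_hasDerivAt
      (0 : ℝ) hpair
    have hz : ((0, 0) : (Fin p → ℝ) × (Fin p → ℝ)) = 0 := rfl
    rw [hz, map_zero] at hcomp
    have hz' : deriv (fun t => w (h (γm t)) (h (γm s₃))) 0 = 0 := hcomp.deriv
    rw [hz'] at this
    exact lt_irrefl _ this
  have hcont : ContinuousAt (fun t => h (γ t)) 0 := hd.continuousAt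
  -- Let the positive time in `key` tend to 0.
  have left : ∀ s₃ ∈ Set.Ioo (-δ) 0, h (γ s₃) = h (γ 0) := by
    intro s₃ hs₃
    have h1 : Tendsto (fun t => h (γ t)) (𝓝[>] 0) (𝓝 (h (γ 0))) :=
      hcont.tendsto.mono_left nhdsWithin_le_nhds
    have h2 : Tendsto (fun t => h (γ t)) (𝓝[>] 0) (𝓝 (h (γ s₃))) := by
      refine tendsto_const_nhds.congr' ?_
      filter_upwards [Ioo_mem_nhdsGT hδ] with t ht using key s₃ hs₃ t ht
    exact tendsto_nhds_unique h2 h1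
  rcases lt_trichotomy t 0 with h' | rfl | h'
  · exact left t ⟨ht.1, h'⟩
  · rfl
  · rw [← key (-δ / 2) ⟨by linarith, by linarith⟩ t ⟨h', ht.2⟩]
    exact left _ ⟨by linarith, by linarith⟩

/-- The geodesic with velocity `v` stays in the level set, so differentiating h ∘ γ twice gives
D²h(v, v) + Dh(γ'') = 0. As P w = dh_i, the geodesic equation tested on `w` evaluates the second
term. -/
lemma hessian_eq_zero_of_unit (hP : ∀ a b, ContDiff ℝ 2 fun x => P x a b)
    (hPos : ∀ x, (P x).PosDef) (hΩ : IsOpen Ω) (hh : ContDiff ℝ 2 h)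
    (hmono : GeodesicallyMonotone P h Ω) {x : Fin n → ℝ} (hx : x ∈ Ω) {v : Fin n → ℝ}
    (hv : fderiv ℝ h x v = 0) (hv1 : matrixBilin (P x) v v = 1) (i : Fin p) {w : Fin n → ℝ}
    (hw : P x *ᵥ w = jacobian h x i) :
    fderiv ℝ (fderiv ℝ h) x v v i = 1 / 2 * koszul (fun y => matrixBilin (P y)) x v v w := by
  have hPc : ContDiff ℝ 2 fun x => matrixBilin (P x) := contDiff_iff_contDiffAt.2 fun x =>
    contDiffAt_matrixBilin fun a b => (hP a b).contDiffAt
  have hhd : Differentiable ℝ h := hh.differentiable (by norm_num)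
  have hhd2 : Differentiable ℝ (fderiv ℝ h) :=
    (hh.fderiv_right (m := 1) (by norm_num)).differentiable (by norm_num)
  obtain ⟨ε, hε, γ, γ', γ'', hγ0, hγ'0, hg, hgeo⟩ := exists_geodesic hP hPos x v
  obtain ⟨δ₁, hδ₁, hδ₁ε, hmin⟩ := exists_isMinimizingOn hPc hPos hε hg
    (by simpa only [hγ0, hγ'0] using hv1)
  have h0 : (0 : ℝ) ∈ Set.Ioo (-ε) ε := ⟨by linarith, hε⟩
  have hγc : ContinuousAt γ 0 := (hg.hasDerivAt 0 h0).continuousAt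
  obtain ⟨δ₂, hδ₂, hball⟩ := Metric.mem_nhds_iff.1
    (hγc.preimage_mem_nhds (hΩ.mem_nhds (hγ0.symm ▸ hx)))
  set δ := min δ₁ δ₂ with hδdef
  have hδ : 0 < δ := lt_min hδ₁ hδ₂
  have hsub₁ : Set.Ioo (-δ) δ ⊆ Set.Ioo (-δ₁) δ₁ :=
    Set.Ioo_subset_Ioo (neg_le_neg (min_le_left _ _)) (min_le_left _ _)
  have hsub : Set.Ioo (-δ) δ ⊆ Set.Ioo (-ε) ε :=
    hsub₁.trans (Set.Ioo_subset_Ioo (neg_le_neg hδ₁ε) hδ₁ε)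
  have hmg : IsMinimizingGeodesicIn P Ω γ (Set.Ioo (-δ) δ) := by
    refine ⟨isOpen_Ioo, Set.ordConnected_Ioo, ⟨0, by linarith, hδ⟩, hgeo.mono hsub,
      fun s hs t ht hst => hmin s (hsub₁ hs) t (hsub₁ ht) hst, fun t ht => hball ?_⟩
    rw [mem_ball_iff_norm, sub_zero, Real.norm_eq_abs, abs_lt]
    exact ⟨by linarith [ht.1, min_le_right δ₁ δ₂], by linarith [ht.2, min_le_right δ₁ δ₂]⟩
  have hηd : ∀ t ∈ Set.Ioo (-ε) ε,
      HasDerivAt (fun t => h (γ t)) (fderiv ℝ h (γ t) (γ' t)) t := fun t ht =>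
    hasDerivAt_comp_normed (hhd (γ t)) (hg.hasDerivAt t ht)
  have hη0 : HasDerivAt (fun t => h (γ t)) 0 0 := by
    have := hηd 0 h0
    rwa [hγ0, hγ'0, hv] at this
  have hδ0 : Set.Ioo (-δ) δ ∈ 𝓝 (0 : ℝ) := Ioo_mem_nhds (by linarith) hδ
  have hconst : ∀ t ∈ Set.Ioo (-δ) δ, fderiv ℝ h (γ t) (γ' t) = 0 := by
    intro t ht
    have h1 : HasDerivAt (fun t => h (γ t)) 0 t :=
      (hasDerivAt_const t (h (γ 0))).congr_of_eventuallyEq (by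
        filter_upwards [isOpen_Ioo.mem_nhds ht] with s hs using
          hmono.eq_of_tangent hmg hη0 hs)
    exact (hηd t (hsub ht)).unique h1
  have hD : HasDerivAt (fun t => fderiv ℝ h (γ t)) (fderiv ℝ (fderiv ℝ h) (γ 0) (γ' 0)) 0 :=
    hasDerivAt_comp_normed (F := (Fin n → ℝ) →L[ℝ] (Fin p → ℝ)) (hhd2 (γ 0)) (hg.hasDerivAt 0 h0)
  have hDD := hasDerivAt_clm_apply_normed hD (hg.hasDerivAt' 0 h0)
  have hzero : HasDerivAt (fun t => fderiv ℝ h (γ t) (γ' t)) 0 0 :=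
    (hasDerivAt_const (0 : ℝ) (0 : Fin p → ℝ)).congr_of_eventuallyEq (by
      filter_upwards [hδ0] with t ht using hconst t ht)
  have hsum := congrFun (hDD.unique hzero) i
  rw [hγ0, hγ'0] at hsum
  have heq := hg.equation 0 h0 w
  rw [hγ0, hγ'0, matrixBilin_apply, hw] at heq
  have hJ : γ'' 0 ⬝ᵥ jacobian h x i = fderiv ℝ h x (γ'' 0) i := by
    rw [← jacobian_mulVec (hhd x), dotProduct_comm]; rfl
  rw [hJ] at heq
  simp only [Pi.add_apply, Pi.zero_apply] at hsum
  linarith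

/-- The level sets of a geodesically monotone map are totally geodesic: the Hessian of the map
vanishes on vectors tangent to its level sets. -/
theorem hessian_eq_zero_of_tangent (hP : ∀ a b, ContDiff ℝ 2 fun x => P x a b)
    (hPos : ∀ x, (P x).PosDef) (hΩ : IsOpen Ω) (hh : ContDiff ℝ 2 h)
    (hmono : GeodesicallyMonotone P h Ω) {x : Fin n → ℝ} (hx : x ∈ Ω) {v : Fin n → ℝ}
    (hv : fderiv ℝ h x v = 0) (i : Fin p) {w : Fin n → ℝ}
    (hw : P x *ᵥ w = jacobian h x i) :
    fderiv ℝ (fderiv ℝ h) x v v i = 1 / 2 * koszul (fun y => matrixBilin (P y)) x v v w := by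
  by_cases hv0 : v = 0
  · subst hv0
    simp [koszul]
  have hpos : 0 < matrixBilin (P x) v v := by
    rw [matrixBilin_apply]
    simpa using (hPos x).dotProduct_mulVec_pos hv0
  set ρ := Real.sqrt (matrixBilin (P x) v v) with hρ
  have hρ0 : 0 < ρ := Real.sqrt_pos.2 hpos
  have hρ2 : ρ * ρ = matrixBilin (P x) v v := Real.mul_self_sqrt hpos.le
  -- Both sides are quadratic in `v`, so normalizing to unit length is harmless.
  have := hessian_eq_zero_of_unit hP hPos hΩ hh hmono hx (v := ρ⁻¹ • v)
    (by rw [map_smul, hv, smul_zero]) (by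
      simp only [map_smul, smul_apply, smul_eq_mul, ← hρ2]
      field_simp) i hw
  simp only [koszul, map_smul, smul_apply, Pi.smul_apply, smul_eq_mul] at this
  simp only [koszul]
  have hne : ρ⁻¹ * ρ⁻¹ ≠ 0 := by positivity
  refine mul_left_cancel₀ hne ?_
  linarith

end Monotone

/-! ### Linear algebra of horizontal lifts and of the modified metric -/

section SubmersionAlgebra

variable {n p : ℕ} {P : Matrix (Fin n) (Fin n) ℝ} {J : Matrix (Fin p) (Fin n) ℝ}
  {Q : Matrix (Fin p) (Fin p) ℝ}

lemma Matrix.PosDef.isSymm_real {m : ℕ} {M : Matrix (Fin m) (Fin m) ℝ} (hM : M.PosDef) :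
    M.IsSymm := by
  simpa using hM.isHermitian

lemma Matrix.PosDef.nonsing_inv_isSymm {m : ℕ} {M : Matrix (Fin m) (Fin m) ℝ} (hM : M.PosDef) :
    (M⁻¹)ᵀ = M⁻¹ :=
  hM.inv.isSymm_real

lemma Matrix.PosDef.isUnit_det_real {m : ℕ} {M : Matrix (Fin m) (Fin m) ℝ} (hM : M.PosDef) :
    IsUnit M.det :=
  hM.det_pos.ne'.isUnit

/-- The metric induced on covectors by a submersion is positive definite. -/
lemma posDef_mul_inv_mul_transpose (hP : P.PosDef) (hJ : J.rank = p) :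
    (J * P⁻¹ * Jᵀ).PosDef := by
  have hinj : Function.Injective J.vecMul := by
    rw [Matrix.vecMul_injective_iff, linearIndependent_iff_card_eq_finrank_span,
      Set.finrank, ← Matrix.rank_eq_finrank_span_row, hJ, Fintype.card_fin]
  simpa using hP.inv.mul_mul_conjTranspose_same hinj

/-- The matrix P⁻¹Jᵀ(JP⁻¹Jᵀ)⁻¹ is the horizontal lift: a right inverse of `J` with values orthogonal
to its kernel. -/
lemma jacobian_mulVec_horizontal (hP : P.PosDef) (hJ : J.rank = p) (y : Fin p → ℝ) :
    J *ᵥ ((P⁻¹ * Jᵀ * (J * P⁻¹ * Jᵀ)⁻¹) *ᵥ y) = y := by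
  have hS := posDef_mul_inv_mul_transpose hP hJ
  rw [Matrix.mulVec_mulVec, ← Matrix.mul_assoc, ← Matrix.mul_assoc,
      Matrix.mul_nonsing_inv _ hS.isUnit_det_real, Matrix.one_mulVec]

lemma metric_mulVec_horizontal (hP : P.PosDef) (y : Fin p → ℝ) :
    P *ᵥ ((P⁻¹ * Jᵀ * (J * P⁻¹ * Jᵀ)⁻¹) *ᵥ y) = Jᵀ *ᵥ ((J * P⁻¹ * Jᵀ)⁻¹ *ᵥ y) := by
  rw [Matrix.mulVec_mulVec, ← Matrix.mul_assoc, ← Matrix.mul_assoc,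
      Matrix.mul_nonsing_inv _ hP.isUnit_det_real, Matrix.one_mul, Matrix.mulVec_mulVec]

/-- The difference of the two sides lies in the kernel of `J` and is orthogonal to it, hence to
itself. -/
lemma exists_horizontal_decomposition (hP : P.PosDef) (hJ : J.rank = p) {v : Fin n → ℝ}
    (hv : ∀ u, J *ᵥ u = 0 → u ⬝ᵥ (P *ᵥ v) = 0) :
    v = (P⁻¹ * Jᵀ * (J * P⁻¹ * Jᵀ)⁻¹) *ᵥ (J *ᵥ v) := by
  set A := (J * P⁻¹ * Jᵀ)⁻¹ with hA
  set X := (P⁻¹ * Jᵀ * A) *ᵥ (J *ᵥ v) with hX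
  have hJX : J *ᵥ X = J *ᵥ v := jacobian_mulVec_horizontal hP hJ _
  have hPX : P *ᵥ X = Jᵀ *ᵥ (A *ᵥ (J *ᵥ v)) := metric_mulVec_horizontal hP _
  have hJw : J *ᵥ (v - X) = 0 := by rw [Matrix.mulVec_sub, hJX, sub_self]
  have hzero : (v - X) ⬝ᵥ (P *ᵥ (v - X)) = 0 := by
    rw [Matrix.mulVec_sub, dotProduct_sub, hv _ hJw, hPX, Matrix.dotProduct_mulVec,
      Matrix.vecMul_transpose, hJw, zero_dotProduct, sub_zero]
  by_contra hne
  have := hP.dotProduct_mulVec_pos (sub_ne_zero.2 hne)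
  simp only [star_trivial] at this
  exact absurd hzero this.ne'

lemma modified_mulVec_of_tangent {v : Fin n → ℝ} (hv : J *ᵥ v = 0) (C : Matrix (Fin p) (Fin p) ℝ) :
    (P + Jᵀ * C * J) *ᵥ v = P *ᵥ v := by
  rw [Matrix.add_mulVec, ← Matrix.mulVec_mulVec, hv, Matrix.mulVec_zero, add_zero]

lemma modified_mul_horizontal (hP : P.PosDef) (hJ : J.rank = p) :
    (P + Jᵀ * (Q - (J * P⁻¹ * Jᵀ)⁻¹) * J) * (P⁻¹ * Jᵀ) = Jᵀ * Q * (J * P⁻¹ * Jᵀ) := by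
  have hS := posDef_mul_inv_mul_transpose hP hJ
  have h1 : P * (P⁻¹ * Jᵀ) = Jᵀ := by
    rw [← Matrix.mul_assoc, Matrix.mul_nonsing_inv _ hP.isUnit_det_real, Matrix.one_mul]
  have h2 : Jᵀ * (Q - (J * P⁻¹ * Jᵀ)⁻¹) * J * (P⁻¹ * Jᵀ) =
      Jᵀ * Q * (J * P⁻¹ * Jᵀ) - Jᵀ * ((J * P⁻¹ * Jᵀ)⁻¹ * (J * P⁻¹ * Jᵀ)) := by
    simp only [Matrix.mul_sub, Matrix.sub_mul, Matrix.mul_assoc]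
  rw [Matrix.add_mul, h1, h2, Matrix.nonsing_inv_mul _ hS.isUnit_det_real, Matrix.mul_one]
  abel

/-- On a lift the subtracted inverse cancels the contribution of `P`. Consequently the gradient of
h_i for the modified metric is the lift of Q⁻¹e_i. -/
lemma modified_mulVec_horizontal (hP : P.PosDef) (hJ : J.rank = p) (y : Fin p → ℝ) :
    (P + Jᵀ * (Q - (J * P⁻¹ * Jᵀ)⁻¹) * J) *ᵥ ((P⁻¹ * Jᵀ * (J * P⁻¹ * Jᵀ)⁻¹) *ᵥ y) =
      Jᵀ *ᵥ (Q *ᵥ y) := by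
  have hS := posDef_mul_inv_mul_transpose hP hJ
  rw [Matrix.mulVec_mulVec, ← Matrix.mul_assoc, modified_mul_horizontal hP hJ,
    Matrix.mul_assoc (Jᵀ * Q), Matrix.mul_nonsing_inv _ hS.isUnit_det_real, Matrix.mul_one,
    Matrix.mulVec_mulVec]

lemma dotProduct_modified_mulVec (C : Matrix (Fin p) (Fin p) ℝ) (u v : Fin n → ℝ) :
    u ⬝ᵥ ((P + Jᵀ * C * J) *ᵥ v) = u ⬝ᵥ (P *ᵥ v) + (J *ᵥ u) ⬝ᵥ (C *ᵥ (J *ᵥ v)) := by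
  rw [Matrix.add_mulVec, dotProduct_add, Matrix.mul_assoc, ← Matrix.mulVec_mulVec,
    Matrix.dotProduct_mulVec u Jᵀ, Matrix.vecMul_transpose, Matrix.mulVec_mulVec]

/-- With X the lift of Jv, the modified form at v is Q(Jv, Jv) + P(v - X, v - X). The first term is
positive unless Jv = 0, and then the value is P(v, v). -/
lemma posDef_modified (hP : P.PosDef) (hJ : J.rank = p) (hQ : Q.PosDef) :
    (P + Jᵀ * (Q - (J * P⁻¹ * Jᵀ)⁻¹) * J).PosDef := by
  have hS := posDef_mul_inv_mul_transpose hP hJ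
  refine Matrix.PosDef.of_dotProduct_mulVec_pos ?_ fun v hv => ?_
  · have hA := hS.nonsing_inv_isSymm
    generalize (J * P⁻¹ * Jᵀ)⁻¹ = A at hA
    rw [Matrix.IsHermitian]
    simp only [Matrix.conjTranspose_eq_transpose_of_trivial, Matrix.transpose_add,
      Matrix.transpose_mul, Matrix.transpose_sub, Matrix.transpose_transpose,
      hA, hP.isSymm_real.eq, hQ.isSymm_real.eq, Matrix.mul_assoc]
  · simp only [star_trivial]
    set A := (J * P⁻¹ * Jᵀ)⁻¹ with hA
    set X := (P⁻¹ * Jᵀ * A) *ᵥ (J *ᵥ v) with hX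
    have hJX : J *ᵥ X = J *ᵥ v := jacobian_mulVec_horizontal hP hJ _
    have hPX : P *ᵥ X = Jᵀ *ᵥ (A *ᵥ (J *ᵥ v)) := metric_mulVec_horizontal hP _
    have hPXu : ∀ u, u ⬝ᵥ (P *ᵥ X) = (J *ᵥ u) ⬝ᵥ (A *ᵥ (J *ᵥ v)) := fun u => by
      rw [hPX, Matrix.dotProduct_mulVec u Jᵀ, Matrix.vecMul_transpose]
    have hsymm : X ⬝ᵥ (P *ᵥ v) = v ⬝ᵥ (P *ᵥ X) := by
      rw [← matrixBilin_apply, ← matrixBilin_apply, matrixBilin_comm hP.isSymm_real]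
    have hdec : (v - X) ⬝ᵥ (P *ᵥ (v - X)) =
        v ⬝ᵥ (P *ᵥ v) - (J *ᵥ v) ⬝ᵥ (A *ᵥ (J *ᵥ v)) := by
      rw [Matrix.mulVec_sub, dotProduct_sub, sub_dotProduct, hPXu, Matrix.mulVec_sub, hJX,
        sub_self, zero_dotProduct, hsymm, hPXu]
      ring
    rw [dotProduct_modified_mulVec, Matrix.sub_mulVec, dotProduct_sub]
    by_cases hJv : J *ᵥ v = 0
    · have := hP.dotProduct_mulVec_pos hv
      simp only [star_trivial] at this
      simpa [hJv] using this
    · have h1 := hQ.dotProduct_mulVec_pos hJv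
      have h2 := hP.posSemidef.dotProduct_mulVec_nonneg (v - X)
      simp only [star_trivial] at h1 h2
      linarith

lemma dotProduct_modified_of_horizontal (hP : P.PosDef) (hJ : J.rank = p) {v : Fin n → ℝ}
    (hv : ∀ u, J *ᵥ u = 0 → u ⬝ᵥ (P *ᵥ v) = 0) :
    v ⬝ᵥ ((P + Jᵀ * (Q - (J * P⁻¹ * Jᵀ)⁻¹) * J) *ᵥ v) = (J *ᵥ v) ⬝ᵥ (Q *ᵥ (J *ᵥ v)) := by
  conv_lhs => enter [2, 2]; rw [exists_horizontal_decomposition hP hJ hv]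
  rw [modified_mulVec_horizontal hP hJ, Matrix.dotProduct_mulVec v Jᵀ, Matrix.vecMul_transpose]

end SubmersionAlgebra

/-! ### Pullback forms and the vertical part of the metric -/

section SecondFundamentalForm

open Filter Topology

variable {n p : ℕ} {h : (Fin n → ℝ) → (Fin p → ℝ)} {x : Fin n → ℝ}

lemma matrixBilin_add {m : ℕ} (M N : Matrix (Fin m) (Fin m) ℝ) :
    matrixBilin (M + N) = matrixBilin M + matrixBilin N := by
  ext u v
  simp only [matrixBilin_apply, add_apply, Matrix.add_mulVec, dotProduct_add]

lemma matrixBilin_congruence (J : Matrix (Fin p) (Fin n) ℝ) (C : Matrix (Fin p) (Fin p) ℝ)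
    (u v : Fin n → ℝ) : matrixBilin (Jᵀ * C * J) u v = matrixBilin C (J *ᵥ u) (J *ᵥ v) := by
  rw [matrixBilin_apply, matrixBilin_apply, Matrix.mul_assoc, ← Matrix.mulVec_mulVec,
    Matrix.dotProduct_mulVec u Jᵀ, Matrix.vecMul_transpose, Matrix.mulVec_mulVec]

lemma contDiffAt_congruence (hh : ContDiff ℝ 2 h)
    {C : (Fin n → ℝ) → Matrix (Fin p) (Fin p) ℝ} (hC : ∀ i j, ContDiffAt ℝ 1 (fun y => C y i j) x)
    (a b : Fin n) : ContDiffAt ℝ 1 (fun y => ((jacobian h y)ᵀ * C y * jacobian h y) a b) x := by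
  have hJ : ∀ i a, ContDiffAt ℝ 1 (fun y => jacobian h y i a) x :=
    contDiffAt_jacobian hh.contDiffAt (by norm_num)
  exact contDiffAt_matrix_mul (contDiffAt_matrix_mul (A := fun y => (jacobian h y)ᵀ)
    (fun a i => hJ i a) hC) hJ a b

/-- The Koszul expression of the pullback of a field of symmetric matrices by a map. -/
lemma koszul_congruence (hh : ContDiff ℝ 2 h)
    {C : (Fin n → ℝ) → Matrix (Fin p) (Fin p) ℝ} (hC : ∀ i j, ContDiffAt ℝ 1 (fun y => C y i j) x)
    (hCs : (C x).IsSymm) (u v w : Fin n → ℝ) :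
    koszul (fun y => matrixBilin ((jacobian h y)ᵀ * C y * jacobian h y)) x u v w =
      2 * matrixBilin (C x) (fderiv ℝ (fderiv ℝ h) x u v) (fderiv ℝ h x w)
      + (fderiv ℝ (fun y => matrixBilin (C y)) x v (fderiv ℝ h x u) (fderiv ℝ h x w)
        + fderiv ℝ (fun y => matrixBilin (C y)) x u (fderiv ℝ h x v) (fderiv ℝ h x w)
        - fderiv ℝ (fun y => matrixBilin (C y)) x w (fderiv ℝ h x u) (fderiv ℝ h x v)) := by
  refine koszul_pullback (B := fun y => matrixBilin (C y)) ?_ ?_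
    (differentiableAt_matrixBilin fun i j => (hC i j).differentiableAt (by norm_num))
    (matrixBilin_comm hCs)
    (differentiableAt_matrixBilin fun i j =>
      (contDiffAt_congruence hh hC i j).differentiableAt (by norm_num)) ?_ u v w
  · exact ((hh.fderiv_right (m := 1) (by norm_num)).differentiable (by norm_num)) x
  · exact fun u v => (hh.contDiffAt.isSymmSndFDerivAt (by simp)) u v
  · refine Eventually.of_forall fun y u v => ?_
    rw [matrixBilin_congruence, jacobian_mulVec (hh.differentiable (by norm_num) y),
      jacobian_mulVec (hh.differentiable (by norm_num) y)]

lemma matrixBilin_of_bilin {m : ℕ} {E : Type*} [NormedAddCommGroup E] [NormedSpace ℝ E]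
    (b : E →L[ℝ] E →L[ℝ] ℝ) (N : (Fin m → ℝ) →L[ℝ] E) (c d : Fin m → ℝ) :
    matrixBilin (Matrix.of fun i j => b (N (Pi.single i 1)) (N (Pi.single j 1))) c d =
      b (N c) (N d) := by
  have hN : ∀ c, N c = ∑ i, c i • N (Pi.single i 1) := fun c => by
    conv_lhs => rw [← Finset.univ_sum_single c, map_sum]
    refine Finset.sum_congr rfl fun i _ => ?_
    rw [← map_smul, ← Pi.single_smul, smul_eq_mul, mul_one]
  rw [matrixBilin_apply_sum, hN c, hN d]
  simp only [map_sum, map_smul, sum_apply, smul_apply, smul_eq_mul, Matrix.of_apply,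
    Finset.mul_sum]
  rw [Finset.sum_comm]
  refine Finset.sum_congr rfl fun i _ => Finset.sum_congr rfl fun j _ => by ring

lemma orthogonalDistribution_of_horizontal {P : (Fin n → ℝ) → Matrix (Fin n) (Fin n) ℝ}
    (hP : (P x).PosDef) (y : Fin p → ℝ) :
    ((P x)⁻¹ * (jacobian h x)ᵀ * (jacobian h x * (P x)⁻¹ * (jacobian h x)ᵀ)⁻¹) *ᵥ y ∈
      orthogonalDistribution P h x := by
  intro u hu
  rw [metric_mulVec_horizontal hP, Matrix.dotProduct_mulVec u, Matrix.vecMul_transpose, hu,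
    zero_dotProduct]

set_option maxHeartbeats 400000 in
/-- When the orthogonal distribution is integrable, the vertical part of the metric is the pullback
of a field of symmetric matrices by the second component of the chart. -/
lemma exists_vertical_form {P : (Fin n → ℝ) → Matrix (Fin n) (Fin n) ℝ} {Ω : Set (Fin n → ℝ)}
    {s : WithTop ℕ∞} (hs : 2 ≤ s)
    (hP : ∀ a b, ContDiff ℝ 2 fun x => P x a b) (hPos : ∀ x, (P x).PosDef)
    (hh : ContDiff ℝ 2 h) (hsub : ∀ x ∈ Ω, (jacobian h x).rank = p)
    (hint : OrthogonalDistributionIntegrable s P h Ω) (hx : x ∈ Ω) :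
    ∃ (k : (Fin n → ℝ) → (Fin (n - p) → ℝ))
      (B : (Fin n → ℝ) → Matrix (Fin (n - p)) (Fin (n - p)) ℝ),
      ContDiffAt ℝ 2 k x ∧ (∀ i j, DifferentiableAt ℝ (fun y => B y i j) x) ∧
      (∀ y, (B y).IsSymm) ∧
      (∀ᶠ y in 𝓝 x, ∀ u v, matrixBilin (P y - (jacobian h y)ᵀ *
        (jacobian h y * (P y)⁻¹ * (jacobian h y)ᵀ)⁻¹ * jacobian h y) u v =
          matrixBilin (B y) (fderiv ℝ k y u) (fderiv ℝ k y v)) ∧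
      (∀ v ∈ orthogonalDistribution P h x, fderiv ℝ k x v = 0) ∧
      ∀ c, ∃ v, fderiv ℝ h x v = 0 ∧ fderiv ℝ k x v = c := by
  obtain ⟨θ, hxθ, hθΩ, hθ, hθs, hθ1, hθk⟩ := hint x hx
  have hhd : Differentiable ℝ h := hh.differentiable (by norm_num)
  have hθd : ∀ y ∈ θ.source, ContDiffAt ℝ 2 θ y := fun y hy =>
    (hθ.contDiffAt (θ.open_source.mem_nhds hy)).of_le hs
  have hθsd : ∀ z ∈ θ.target, ContDiffAt ℝ 2 θ.symm z := fun z hz =>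
    (hθs.contDiffAt (θ.open_target.mem_nhds hz)).of_le hs
  -- Differential of the inverse chart along the second factor: it yields vertical vectors and is a
  -- right inverse of Dk. The form `B` is the metric read through it.
  set N : (Fin n → ℝ) → (Fin (n - p) → ℝ) →L[ℝ] (Fin n → ℝ) := fun y =>
    (fderiv ℝ θ.symm (θ y)).comp (ContinuousLinearMap.inr ℝ (Fin p → ℝ) (Fin (n - p) → ℝ)) with hN
  have hθ' : ∀ y ∈ θ.source, ∀ v, fderiv ℝ θ y v =
      (fderiv ℝ h y v, fderiv ℝ (fun z => (θ z).2) y v) := by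
    intro y hy v
    have hd := ((hθd y hy).differentiableAt (by norm_num)).hasFDerivAt
    have h2 : HasFDerivAt (fun z => (θ z).2) _ y := hd.snd
    have h1 : HasFDerivAt h _ y := hd.fst.congr_of_eventuallyEq (by
      filter_upwards [θ.open_source.mem_nhds hy] with z hz using (hθ1 z hz).symm)
    rw [h2.fderiv, h1.fderiv]
    rfl
  have hleft : ∀ y ∈ θ.source, ∀ v, fderiv ℝ θ.symm (θ y) (fderiv ℝ θ y v) = v := by
    intro y hy v
    have h1 := ((hθd y hy).differentiableAt (by norm_num)).hasFDerivAt
    have h2 := ((hθsd _ (θ.map_source hy)).differentiableAt (by norm_num)).hasFDerivAt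
    have h3 := (h2.comp y h1).congr_of_eventuallyEq (f₁ := id) (by
      filter_upwards [θ.open_source.mem_nhds hy] with z hz using (θ.left_inv hz).symm)
    exact congrArg (fun T => T v) (h3.unique (hasFDerivAt_id y))
  have hright : ∀ y ∈ θ.source, ∀ q, fderiv ℝ θ y (fderiv ℝ θ.symm (θ y) q) = q := by
    intro y hy q
    have h1 := ((hθd y hy).differentiableAt (by norm_num)).hasFDerivAt
    have h2 := ((hθsd _ (θ.map_source hy)).differentiableAt (by norm_num)).hasFDerivAt
    have h1' : HasFDerivAt θ (fderiv ℝ θ y) (θ.symm (θ y)) := by rwa [θ.left_inv hy]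
    have h3 := (h1'.comp (θ y) h2).congr_of_eventuallyEq (f₁ := id) (by
      filter_upwards [θ.open_target.mem_nhds (θ.map_source hy)] with z hz
        using (θ.right_inv hz).symm)
    exact congrArg (fun T => T q) (h3.unique (hasFDerivAt_id _))
  have hNc : ∀ y ∈ θ.source, ∀ c, fderiv ℝ h y (N y c) = 0 ∧
      fderiv ℝ (fun z => (θ z).2) y (N y c) = c := by
    intro y hy c
    have := hright y hy (0, c)
    rw [hθ' y hy] at this
    exact Prod.ext_iff.1 this
  refine ⟨fun z => (θ z).2, fun y => Matrix.of fun i j =>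
    matrixBilin (P y) (N y (Pi.single i 1)) (N y (Pi.single j 1)), ?_, fun i j => ?_, fun y => ?_,
    ?_, hθk x hxθ, fun c => ⟨N x c, hNc x hxθ c⟩⟩
  · exact (hθd x hxθ).snd
  · have hNd : ∀ c, DifferentiableAt ℝ (fun y => N y c) x := by
      intro c
      have h1 : ContDiffAt ℝ 1 (fderiv ℝ θ.symm) (θ x) :=
        (hθsd _ (θ.map_source hxθ)).fderiv_right (by norm_num)
      have h2 := (h1.differentiableAt (by norm_num)).comp x
        ((hθd x hxθ).differentiableAt (by norm_num))
      exact h2.clm_apply (differentiableAt_const _)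
    have hPd : DifferentiableAt ℝ (fun y => matrixBilin (P y)) x :=
      differentiableAt_matrixBilin fun a b => (hP a b).differentiable (by norm_num) x
    exact (hPd.clm_apply (hNd _)).clm_apply (hNd _)
  · ext i j
    exact matrixBilin_comm (hPos y).isSymm_real _ _
  · filter_upwards [θ.open_source.mem_nhds hxθ] with y hy u v
    have hJ := hsub y (hθΩ hy)
    set X : (Fin p → ℝ) → (Fin n → ℝ) := fun c => ((P y)⁻¹ * (jacobian h y)ᵀ *
      (jacobian h y * (P y)⁻¹ * (jacobian h y)ᵀ)⁻¹) *ᵥ c with hX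
    have hkX : ∀ c, fderiv ℝ (fun z => (θ z).2) y (X c) = 0 := fun c =>
      hθk y hy _ (orthogonalDistribution_of_horizontal (hPos y) c)
    have hJX : ∀ c, fderiv ℝ h y (X c) = c := fun c => by
      rw [← jacobian_mulVec (hhd y)]
      exact jacobian_mulVec_horizontal (hPos y) hJ c
    -- Integrability enters through `hkX`: both sides have the same image under the injective
    -- differential of the chart.
    have hdec : ∀ u, u = N y (fderiv ℝ (fun z => (θ z).2) y u) + X (fderiv ℝ h y u) := by
      intro u
      rw [← sub_eq_zero]
      set w := u - (N y (fderiv ℝ (fun z => (θ z).2) y u) + X (fderiv ℝ h y u)) with hw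
      have : fderiv ℝ θ y w = 0 := by
        rw [hθ' y hy, hw]
        simp only [map_sub, map_add, (hNc y hy _).1, (hNc y hy _).2, hkX, hJX, zero_add, add_zero,
          sub_self]
        rfl
      rw [← hleft y hy w, this, map_zero]
    have hPX : ∀ u c, matrixBilin (P y) u (X c) = fderiv ℝ h y u ⬝ᵥ
        ((jacobian h y * (P y)⁻¹ * (jacobian h y)ᵀ)⁻¹ *ᵥ c) := by
      intro u c
      rw [matrixBilin_apply, metric_mulVec_horizontal (hPos y), Matrix.dotProduct_mulVec u,
        Matrix.vecMul_transpose, jacobian_mulVec (hhd y)]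
    rw [matrixBilin_of_bilin (matrixBilin (P y)) (N y), matrixBilin_apply, Matrix.sub_mulVec,
      dotProduct_sub, ← matrixBilin_apply, ← matrixBilin_apply, matrixBilin_congruence,
      jacobian_mulVec (hhd y), jacobian_mulVec (hhd y), matrixBilin_apply _ (fderiv ℝ h y u)]
    have hsymm := matrixBilin_comm (hPos y).isSymm_real
    -- The mixed terms vanish, as one vector is vertical and the other horizontal.
    have e1 : matrixBilin (P y) u v = matrixBilin (P y) (N y (fderiv ℝ (fun z => (θ z).2) y u))
        (N y (fderiv ℝ (fun z => (θ z).2) y v)) + fderiv ℝ h y u ⬝ᵥ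
        ((jacobian h y * (P y)⁻¹ * (jacobian h y)ᵀ)⁻¹ *ᵥ fderiv ℝ h y v) := by
      conv_lhs => rw [hdec v]
      rw [map_add, hPX]
      conv_lhs => rw [hdec u]
      rw [map_add, add_apply, hsymm (X _), hPX, (hNc y hy _).1, zero_dotProduct, add_zero,
        map_add, (hNc y hy _).1, hJX, zero_add]
    rw [e1]; ring

end SecondFundamentalForm

/-! ### Vanishing of the second fundamental form -/

section MainResult

open Filter Topology

variable {n p : ℕ} {h : (Fin n → ℝ) → (Fin p → ℝ)} {x : Fin n → ℝ}
  {P : (Fin n → ℝ) → Matrix (Fin n) (Fin n) ℝ} {Ω : Set (Fin n → ℝ)}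

lemma contDiffAt_covectorMetric_inv {r s : WithTop ℕ∞} (hr : r + 1 ≤ s)
    (hP : ∀ a b, ContDiff ℝ s fun x => P x a b) (hPos : (P x).PosDef) (hh : ContDiff ℝ s h)
    (hJ : (jacobian h x).rank = p) (i j : Fin p) :
    ContDiffAt ℝ r (fun y => (jacobian h y * (P y)⁻¹ * (jacobian h y)ᵀ)⁻¹ i j) x := by
  have hJc : ∀ i a, ContDiffAt ℝ r (fun y => jacobian h y i a) x :=
    contDiffAt_jacobian hh.contDiffAt hr
  have hrs : r ≤ s := le_self_add.trans hr
  refine contDiffAt_matrix_inv (A := fun y => jacobian h y * (P y)⁻¹ * (jacobian h y)ᵀ)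
    (fun i j => ?_) (posDef_mul_inv_mul_transpose hPos hJ).det_pos.ne' i j
  exact contDiffAt_matrix_mul (A := fun y => jacobian h y * (P y)⁻¹)
    (C := fun y => (jacobian h y)ᵀ) (contDiffAt_matrix_mul hJc (contDiffAt_matrix_inv
      (fun a b => ((hP a b).of_le hrs).contDiffAt) hPos.det_pos.ne')) (fun a i => hJc i a) i j

/-- The vertical part of the metric is invariant in the horizontal directions when the level sets
are totally geodesic and the orthogonal distribution is integrable. -/
lemma koszul_vertical_eq_zero {s : WithTop ℕ∞} (hs : 2 ≤ s)
    (hP : ∀ a b, ContDiff ℝ 2 fun x => P x a b) (hPos : ∀ x, (P x).PosDef) (hΩ : IsOpen Ω)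
    (hh : ContDiff ℝ 2 h) (hsub : ∀ x ∈ Ω, (jacobian h x).rank = p)
    (hmono : GeodesicallyMonotone P h Ω)
    (hint : OrthogonalDistributionIntegrable s P h Ω) (hx : x ∈ Ω) (u v : Fin n → ℝ)
    (e : Fin p → ℝ) :
    koszul (fun y => matrixBilin (P y - (jacobian h y)ᵀ *
        (jacobian h y * (P y)⁻¹ * (jacobian h y)ᵀ)⁻¹ * jacobian h y)) x u v
      (((P x)⁻¹ * (jacobian h x)ᵀ * (jacobian h x * (P x)⁻¹ * (jacobian h x)ᵀ)⁻¹) *ᵥ e) = 0 := by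
  obtain ⟨k, B, hk, hB, hBs, hR, hkH, hkV⟩ := exists_vertical_form hs hP hPos hh hsub hint hx
  have hhd : Differentiable ℝ h := hh.differentiable (by norm_num)
  have hJ := hsub x hx
  have hS := posDef_mul_inv_mul_transpose (hPos x) hJ
  set A : (Fin n → ℝ) → Matrix (Fin p) (Fin p) ℝ := fun y =>
    (jacobian h y * (P y)⁻¹ * (jacobian h y)ᵀ)⁻¹ with hA
  have hAc : ∀ i j, ContDiffAt ℝ 1 (fun y => A y i j) x :=
    contDiffAt_covectorMetric_inv (by norm_num) hP (hPos x) hh hJ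
  have hJAJ := contDiffAt_congruence hh hAc
  have hPd : ∀ a b, DifferentiableAt ℝ (fun y => P y a b) x := fun a b =>
    (hP a b).differentiable (by norm_num) x
  have hRd : ∀ a b, DifferentiableAt ℝ (fun y => (P y - (jacobian h y)ᵀ * A y * jacobian h y) a b)
      x := fun a b => (hPd a b).sub ((hJAJ a b).differentiableAt (by norm_num))
  set R : (Fin n → ℝ) → Matrix (Fin n) (Fin n) ℝ := fun y =>
    P y - (jacobian h y)ᵀ * A y * jacobian h y with hRdef
  have hRb := differentiableAt_matrixBilin hRd
  have hBb := differentiableAt_matrixBilin hB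
  -- For `w` in the kernel of Dk only the derivative of `B` along `w` survives.
  have hpull : ∀ u v w, fderiv ℝ k x w = 0 → koszul (fun y => matrixBilin (R y)) x u v w =
      - fderiv ℝ (fun y => matrixBilin (B y)) x w (fderiv ℝ k x u) (fderiv ℝ k x v) := by
    intro u v w hw
    rw [koszul_pullback (B := fun y => matrixBilin (B y)) (k := k)
      ((hk.fderiv_right (m := 1) (by norm_num)).differentiableAt (by norm_num))
      (fun u v => (hk.isSymmSndFDerivAt (by simp)) u v) hBb (matrixBilin_comm (hBs x)) hRb hR, hw]
    simp
  set X : (Fin p → ℝ) → (Fin n → ℝ) := fun c =>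
    ((P x)⁻¹ * (jacobian h x)ᵀ * (jacobian h x * (P x)⁻¹ * (jacobian h x)ᵀ)⁻¹) *ᵥ c with hX
  have hkX : ∀ c, fderiv ℝ k x (X c) = 0 := fun c =>
    hkH _ (orthogonalDistribution_of_horizontal (hPos x) c)
  have hJX : ∀ c, fderiv ℝ h x (X c) = c := fun c => by
    rw [← jacobian_mulVec (hhd x)]
    exact jacobian_mulVec_horizontal (hPos x) hJ c
  have hPX : ∀ c, P x *ᵥ X c = (jacobian h x)ᵀ *ᵥ (A x *ᵥ c) := fun c =>
    metric_mulVec_horizontal (hPos x) c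
  set S := jacobian h x * (P x)⁻¹ * (jacobian h x)ᵀ with hSdef
  have hAS : ∀ c, A x *ᵥ (S *ᵥ c) = c := fun c => by
    rw [Matrix.mulVec_mulVec, hA]
    exact (congrArg (· *ᵥ c) (Matrix.nonsing_inv_mul _ hS.isUnit_det_real)).trans
      (Matrix.one_mulVec c)
  -- The vector X(S e_i) is the `P`-gradient of h_i. For vertical v the totally geodesic identity
  -- reads 2 D²h_i(v, v) = Koszul of P; the summand JᵀAJ already contributes 2 D²h_i(v, v), so that
  -- of `R` is zero.
  have hquad : ∀ i c, fderiv ℝ (fun y => matrixBilin (B y)) x (X (S *ᵥ Pi.single i 1)) c c = 0 := by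
    intro i c
    obtain ⟨v, hv, rfl⟩ := hkV c
    have hw : P x *ᵥ X (S *ᵥ Pi.single i 1) = jacobian h x i := by
      rw [hPX, hAS, Matrix.mulVec_single_one]
      rfl
    have h1 := hessian_eq_zero_of_tangent hP hPos hΩ hh hmono hx hv i hw
    have h2 : koszul (fun y => matrixBilin (P y)) x v v (X (S *ᵥ Pi.single i 1)) =
        koszul (fun y => matrixBilin ((jacobian h y)ᵀ * A y * jacobian h y)) x v v
          (X (S *ᵥ Pi.single i 1)) +
        koszul (fun y => matrixBilin (R y)) x v v (X (S *ᵥ Pi.single i 1)) := by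
      rw [← koszul_add (differentiableAt_matrixBilin fun a b =>
        (hJAJ a b).differentiableAt (by norm_num)) hRb]
      refine koszul_congr (Eventually.of_forall fun y => ?_) _ _ _
      simp only [← matrixBilin_add, add_sub_cancel]
    have hAsymm : (A x).IsSymm := hS.nonsing_inv_isSymm
    have h3 : matrixBilin (A x) (fderiv ℝ (fderiv ℝ h) x v v) (S *ᵥ Pi.single i 1) =
        fderiv ℝ (fderiv ℝ h) x v v i := by
      rw [matrixBilin_apply, hAS, dotProduct_single_one]
    rw [h2, koszul_congruence hh hAc hAsymm, hpull _ _ _ (hkX _), hJX, h3, hv] at h1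
    simp only [map_zero, zero_apply] at h1
    linarith
  have hBsymm : ∀ w c d, fderiv ℝ (fun y => matrixBilin (B y)) x w c d =
      fderiv ℝ (fun y => matrixBilin (B y)) x w d c := by
    intro w c d
    rw [fderiv_matrixBilin hB, fderiv_matrixBilin hB, Finset.sum_comm]
    refine Finset.sum_congr rfl fun i _ => Finset.sum_congr rfl fun j _ => ?_
    have : (fun y => B y j i) = fun y => B y i j := funext fun y => (hBs y).apply i j
    rw [this]; ring
  have hpol : ∀ i c d, fderiv ℝ (fun y => matrixBilin (B y)) x (X (S *ᵥ Pi.single i 1)) c d = 0 := by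
    intro i c d
    have h1 := hquad i (c + d)
    simp only [map_add, add_apply, hquad, hBsymm _ d c] at h1
    linarith
  -- The gradients of the components span the horizontal vectors.
  have hsum : X e = ∑ i, (A x *ᵥ e) i • X (S *ᵥ Pi.single i 1) := by
    have h1 : e = S *ᵥ (A x *ᵥ e) := by
      rw [Matrix.mulVec_mulVec, hA]
      exact ((congrArg (· *ᵥ e) (Matrix.mul_nonsing_inv _ hS.isUnit_det_real)).trans
        (Matrix.one_mulVec e)).symm
    have h2 : A x *ᵥ e = ∑ i, (A x *ᵥ e) i • (Pi.single i 1 : Fin p → ℝ) := by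
      conv_lhs => rw [← Finset.univ_sum_single (A x *ᵥ e)]
      refine Finset.sum_congr rfl fun i _ => ?_
      rw [← Pi.single_smul, smul_eq_mul, mul_one]
    have h3 : ∀ c, X c = Matrix.mulVecLin ((P x)⁻¹ * (jacobian h x)ᵀ * S⁻¹) c := fun c => rfl
    have h4 : ∀ c, S *ᵥ c = Matrix.mulVecLin S c := fun c => rfl
    conv_lhs => rw [h1, h2]
    simp only [h3, h4, map_sum, map_smul]
  rw [show koszul _ x u v (X e) = _ from hpull u v (X e) (hkX e), hsum, map_sum]
  simp only [map_smul, sum_apply, smul_apply, hpol, smul_zero, Finset.sum_const_zero, neg_zero]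

/-- The second fundamental form vanishes for the modified metric. -/
theorem secondFundamentalForm_modifiedMetric_eq_zero {s : WithTop ℕ∞} (hs : 2 ≤ s)
    {Q : (Fin p → ℝ) → Matrix (Fin p) (Fin p) ℝ}
    (hP : ∀ a b, ContDiff ℝ 2 fun x => P x a b) (hPos : ∀ x, (P x).PosDef)
    (hQ : ∀ a b, ContDiff ℝ 2 fun y => Q y a b) (hQPos : ∀ y, (Q y).PosDef) (hΩ : IsOpen Ω)
    (hh : ContDiff ℝ 2 h) (hsub : ∀ x ∈ Ω, (jacobian h x).rank = p)
    (hmono : GeodesicallyMonotone P h Ω)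
    (hint : OrthogonalDistributionIntegrable s P h Ω) (hx : x ∈ Ω) (i : Fin p) (a b : Fin n) :
    secondFundamentalForm (modifiedMetric P Q h) Q h i a b x = 0 := by
  have hhd : Differentiable ℝ h := hh.differentiable (by norm_num)
  have hhd2 : Differentiable ℝ (fderiv ℝ h) :=
    (hh.fderiv_right (m := 1) (by norm_num)).differentiable (by norm_num)
  have hJ := hsub x hx
  set A : (Fin n → ℝ) → Matrix (Fin p) (Fin p) ℝ := fun y =>
    (jacobian h y * (P y)⁻¹ * (jacobian h y)ᵀ)⁻¹ with hA
  have hAc : ∀ i j, ContDiffAt ℝ 1 (fun y => A y i j) x :=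
    contDiffAt_covectorMetric_inv (by norm_num) hP (hPos x) hh hJ
  have hQc : ∀ i j, ContDiffAt ℝ 1 (fun y => Q (h y) i j) x := fun i j =>
    (((hQ i j).comp hh).of_le (by norm_num)).contDiffAt
  have hQd : ∀ i j, DifferentiableAt ℝ (fun y => Q y i j) (h x) := fun i j =>
    (hQ i j).differentiable (by norm_num) _
  have hJAJ := contDiffAt_congruence hh hAc
  have hJQJ := contDiffAt_congruence hh hQc
  have hRd : ∀ a b, DifferentiableAt ℝ (fun y => (P y - (jacobian h y)ᵀ * A y * jacobian h y) a b)
      x := fun a b => ((hP a b).differentiable (by norm_num) x).sub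
        ((hJAJ a b).differentiableAt (by norm_num))
  -- Pullback of `Q` plus the vertical part of the original metric.
  have hMeq : ∀ y, modifiedMetric P Q h y = (jacobian h y)ᵀ * Q (h y) * jacobian h y +
      (P y - (jacobian h y)ᵀ * A y * jacobian h y) := fun y => by
    simp only [modifiedMetric, hA, Matrix.mul_sub, Matrix.sub_mul]
    abel
  have hMd : ∀ a b, DifferentiableAt ℝ (fun y => modifiedMetric P Q h y a b) x := fun a b => by
    simp only [hMeq]
    exact ((hJQJ a b).differentiableAt (by norm_num)).add (hRd a b)
  have hMpos : (modifiedMetric P Q h x).PosDef := posDef_modified (hPos x) hJ (hQPos _)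
  -- The `Q`-gradient of the i-th coordinate; its lift `X` is the gradient of h_i for the modified
  -- metric.
  set q : Fin p → ℝ := (Q (h x))⁻¹ *ᵥ Pi.single i 1 with hq
  have hQq : Q (h x) *ᵥ q = Pi.single i 1 := by
    rw [hq, Matrix.mulVec_mulVec, Matrix.mul_nonsing_inv _ (hQPos _).isUnit_det_real,
      Matrix.one_mulVec]
  set X := ((P x)⁻¹ * (jacobian h x)ᵀ * (jacobian h x * (P x)⁻¹ * (jacobian h x)ᵀ)⁻¹) *ᵥ q with hX
  have hMX : modifiedMetric P Q h x *ᵥ X = jacobian h x i := by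
    have := modified_mulVec_horizontal (Q := Q (h x)) (hPos x) hJ q
    rw [hQq, Matrix.mulVec_single_one] at this
    exact this
  have hJX : fderiv ℝ h x X = q := by
    rw [← jacobian_mulVec (hhd x)]
    exact jacobian_mulVec_horizontal (hPos x) hJ q
  set u : Fin n → ℝ := Pi.single a 1 with hu
  set v : Fin n → ℝ := Pi.single b 1 with hv
  have hkosM : koszul (fun y => matrixBilin (modifiedMetric P Q h y)) x u v X =
      koszul (fun y => matrixBilin ((jacobian h y)ᵀ * Q (h y) * jacobian h y)) x u v X := by
    have h1 := koszul_vertical_eq_zero hs hP hPos hΩ hh hsub hmono hint hx u v q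
    rw [← add_zero (koszul (fun y => matrixBilin ((jacobian h y)ᵀ * Q (h y) * jacobian h y)) x u v X),
      ← h1, ← koszul_add (differentiableAt_matrixBilin fun a b =>
        (hJQJ a b).differentiableAt (by norm_num)) (differentiableAt_matrixBilin hRd)]
    refine koszul_congr (Eventually.of_forall fun y => ?_) _ _ _
    simp only [hMeq, matrixBilin_add, hA]
  have hQh : ∀ w, fderiv ℝ (fun y => matrixBilin (Q (h y))) x w =
      fderiv ℝ (fun y => matrixBilin (Q y)) (h x) (fderiv ℝ h x w) := by
    intro w
    have := ((differentiableAt_matrixBilin hQd).hasFDerivAt.comp x (hhd x).hasFDerivAt).fderiv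
    exact congrArg (fun T => T w) this
  have hQD : ∀ c, matrixBilin (Q (h x)) c q = c i := fun c => by
    rw [matrixBilin_apply, hQq, dotProduct_single_one]
  have hkosQ : koszul (fun y => matrixBilin (modifiedMetric P Q h y)) x u v X =
      2 * fderiv ℝ (fderiv ℝ h) x u v i +
        koszul (fun y => matrixBilin (Q y)) (h x) (fderiv ℝ h x u) (fderiv ℝ h x v) q := by
    rw [hkosM, koszul_congruence hh hQc (hQPos _).isSymm_real, hJX, hQD, hQh, hQh, hQh, hJX]
    rfl
  have hΓ : ∑ c, christoffel (modifiedMetric P Q h) c a b x * partialDeriv c (fun z => h z i) x =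
      1 / 2 * koszul (fun y => matrixBilin (modifiedMetric P Q h y)) x u v X := by
    rw [← sum_christoffel_mul hMd hMpos.isSymm_real hMpos.isUnit_det_real, hMX]
    refine Finset.sum_congr rfl fun c _ => ?_
    congr 1
    simp [hu, hv, Pi.single_apply]
  have hpart : ∀ (a : Fin n) j, partialDeriv a (fun z => h z j) x =
      fderiv ℝ h x (Pi.single a 1) j := fun a j => fderiv_component (hhd x) j _
  have hΔ : ∑ j, ∑ k, christoffel Q i j k (h x) *
        partialDeriv a (fun z => h z j) x * partialDeriv b (fun z => h z k) x =
      1 / 2 * koszul (fun y => matrixBilin (Q y)) (h x) (fderiv ℝ h x u) (fderiv ℝ h x v) q := by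
    rw [← sum_christoffel_mul hQd (hQPos _).isSymm_real (hQPos _).isUnit_det_real, hQq]
    simp [Pi.single_apply, hpart, hu, hv]
  have hH : partialDeriv a (partialDeriv b (fun z => h z i)) x =
      fderiv ℝ (fderiv ℝ h) x u v i := by
    have h1 : partialDeriv b (fun z => h z i) = fun y => fderiv ℝ h y v i := by
      funext y; exact fderiv_component (hhd y) i _
    have h2 : HasFDerivAt (fun y => fderiv ℝ h y v) ((fderiv ℝ (fderiv ℝ h) x).flip v) x := by
      convert! (hhd2 x).hasFDerivAt.clm_apply (hasFDerivAt_const v x) using 1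
      ext z; simp
    rw [h1]
    have h3 := fderiv_component h2.differentiableAt i u
    rw [h2.fderiv] at h3
    exact h3
  -- Half of `hkosQ` is the Hessian plus half the Koszul expression of `Q`, and these cancel the
  -- other two terms.
  rw [secondFundamentalForm, hH, hΓ, hΔ, hkosQ]
  ring

end MainResult

end

/-! ### The main theorem -/

theorem mainTheorem2 (n p : ℕ) (s : WithTop ℕ∞) (hs : 3 ≤ s)
    (Ω : Set (Fin n → ℝ)) (hΩ : IsOpen Ω)
    (h : (Fin n → ℝ) → (Fin p → ℝ)) (hh : ContDiff ℝ s h)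
    (hsub : ∀ x ∈ Ω, (jacobian h x).rank = p)
    (P : (Fin n → ℝ) → Matrix (Fin n) (Fin n) ℝ) (hP : IsRiemannianMetricOn s Set.univ P)
    (Q : (Fin p → ℝ) → Matrix (Fin p) (Fin p) ℝ) (hQ : IsRiemannianMetricOn s Set.univ Q)
    (hmono : GeodesicallyMonotone P h Ω)
    (hint : OrthogonalDistributionIntegrable s P h Ω) :
    (∀ r : WithTop ℕ∞, r + 1 ≤ s → IsRiemannianMetricOn r Ω (modifiedMetric P Q h)) ∧
    (∀ x ∈ Ω, ∀ u, ∀ v ∈ tangentDistribution h x,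
      u ⬝ᵥ (modifiedMetric P Q h x *ᵥ v) = u ⬝ᵥ (P x *ᵥ v)) ∧
    IsRiemannianSubmersionOn (modifiedMetric P Q h) Q h Ω ∧
    ∀ x ∈ Ω, ∀ i a b, secondFundamentalForm (modifiedMetric P Q h) Q h i a b x = 0 := by
  have hPc : ∀ a b, ContDiff ℝ s fun x => P x a b := fun a b => contDiffOn_univ.1 (hP.1 a b)
  have hQc : ∀ a b, ContDiff ℝ s fun x => Q x a b := fun a b => contDiffOn_univ.1 (hQ.1 a b)
  have hPos : ∀ x, (P x).PosDef := fun x => hP.2 x trivial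
  have hQPos : ∀ x, (Q x).PosDef := fun x => hQ.2 x trivial
  have hs2 : 2 ≤ s := le_trans (by norm_num) hs
  have htan : ∀ x, ∀ v ∈ tangentDistribution h x, modifiedMetric P Q h x *ᵥ v = P x *ᵥ v :=
    fun x v hv => modified_mulVec_of_tangent hv _
  refine ⟨fun r hr => ⟨fun a b x hx => ?_, fun x hx =>
    posDef_modified (hPos x) (hsub x hx) (hQPos _)⟩, fun x _ u v hv => by rw [htan x v hv],
    fun x hx => ⟨hsub x hx, fun v hv => ?_⟩, fun x hx i a b => ?_⟩
  · have hrs : r ≤ s := le_self_add.trans hr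
    have hJ : ∀ i a, ContDiffAt ℝ r (fun y => jacobian h y i a) x :=
      contDiffAt_jacobian hh.contDiffAt hr
    have hA := contDiffAt_covectorMetric_inv hr hPc (hPos x) hh (hsub x hx)
    have hC : ∀ i j, ContDiffAt ℝ r (fun y => (Q (h y) -
        (jacobian h y * (P y)⁻¹ * (jacobian h y)ᵀ)⁻¹) i j) x := fun i j =>
      (((hQc i j).comp hh).of_le hrs).contDiffAt.sub (hA i j)
    exact (((hPc a b).of_le hrs).contDiffAt.add (contDiffAt_matrix_mul (contDiffAt_matrix_mul
      (A := fun y => (jacobian h y)ᵀ) (fun a i => hJ i a) hC) hJ a b)).contDiffWithinAt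
  -- The two metrics agree when one argument is vertical, so they have the same orthogonal
  -- distribution.
  · refine (dotProduct_modified_of_horizontal (hPos x) (hsub x hx) fun u hu => ?_).symm
    have hsymm : ∀ {M : Matrix (Fin n) (Fin n) ℝ}, M.PosDef → ∀ u v, u ⬝ᵥ (M *ᵥ v) =
        v ⬝ᵥ (M *ᵥ u) := fun hM u v => by
      rw [← matrixBilin_apply, ← matrixBilin_apply, matrixBilin_comm hM.isSymm_real]
    have h1 := hv u hu
    have hM : (modifiedMetric P Q h x).PosDef := posDef_modified (hPos x) (hsub x hx) (hQPos _)
    rwa [hsymm hM, htan x u hu, hsymm (hPos x)] at h1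
  · exact secondFundamentalForm_modifiedMetric_eq_zero hs2
      (fun a b => (hPc a b).of_le hs2) hPos (fun a b => (hQc a b).of_le hs2) hQPos hΩ
      (hh.of_le hs2) hsub hmono hint hx i a b
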